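/- Consider the switched linear system $\dot x=A_{\sigma(t)}x+B_{\sigma(t)}u$, $x\in\mathbb R^n$, $u\in\mathbb R^m$, $\sigma(t)\in\Sigma=\{1,\dots,N\}$, $N\ge1$, where each pair $(A_\sigma,B_\sigma)$ is controllable. Switching signals are right-continuous, piecewise constant functions on $[0,\infty)$ with finitely many switches on bounded intervals, and solutions are understood in Filippov's sense. Assume the following. 1. The linear equations $A_\sigma G_0-G_0A_\sigma+B_\sigma Y_{0,\sigma}=A_\sigma$, $G_0B_\sigma=0$ ($\sigma\in\Sigma$) have a solution $G_0\in\mathbb R^{n\times n}$, $Y_{0,\sigma}\in\mathbb R^{m\times n}$ with common $G_0$. For $\mu\in\mathbb R$ put $G_{\mathbf d}=I_n+\mu G_0$, $\mathbf d(s)=e^{sG_{\mathbf d}}$, $K_{0,\sigma}=Y_{0,\sigma}(G_0-I_n)^{-1}$, $A_{0,\sigma}=A_\sigma+B_\sigma K_{0,\sigma}$. 2. For each $\sigma\in\Sigma$ there are $X_\sigma\succ0$, $Y_\sigma\in\mathbb R^{m\times n}$ and $\rho_\sigma>0$ with $$X_\sigma A_{0,\sigma}^\top+A_{0,\sigma}X_\sigma+B_\sigma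 Y_\sigma+Y_\sigma^\top B_\sigma^\top+\rho_\sigma(G_{\mathbf d}X_\sigma+X_\sigma G_{\mathbf d}^\top)\preceq0,\qquad G_{\mathbf d}X_\sigma+X_\sigma G_{\mathbf d}^\top\succ0 .$$ Let $P_\sigma=X_\sigma^{-1}$, $K_\sigma=Y_\sigma X_\sigma^{-1}$, let $V_\sigma$ be the canonical homogeneous norm induced by $\|x\|_{P_\sigma}=\sqrt{x^\top P_\sigma x}$ (that is, $V_\sigma(0)=0$, and $V_\sigma(x)=e^{s}$ with $\|\mathbf d(-s)x\|_{P_\sigma}=1$ for $x\ne0$), and close the loop, in mode $\sigma$, by $$u(x)=K_{0,\sigma}x+V_\sigma(x)^{1+\mu}K_\sigma\,\mathbf d(-\ln V_\sigma(x))\,x .$$ Let $f_\sigma$ be the resulting closed-loop vector field of mode $\sigma$. Then: * $G_0-I_n$ is invertible, $I_n+\nu G_0$ is anti-Hurwitz for all $\nu\in\mathbb R$ sufficiently close to zero, and $A_{0,\sigma}G_{\mathbf d}=(G_{\mathbf d}+\mu I_n)A_{0,\sigma}$, $G_{\mathbf d}B_\sigma=B_\sigma$ for all $\sigma\in\Sigma$.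 * Each $V_\sigma$ is well defined (the number $s$ exists and is unique for $x\neq 0$), continuous, positive definite, radially unbounded and $C^1$ on $\mathbb R^n\setminus\{0\}$; there is $\gamma>1$ with $V_{\sigma'}(x)\le\gamma V_\sigma(x)$ for all $\sigma,\sigma'\in\Sigma$, $x\in\mathbb R^n$. * Along the trajectories of mode $\sigma$, $\dot V_\sigma(x)=\nabla V_\sigma(x)\cdot f_\sigma(x)\le-\rho_\sigma V_\sigma(x)^{1+\mu}$ for all $x\ne0$. * The closed-loop system is $\mathbf d$-homogeneous of degree $\mu$: $f_\sigma(\mathbf d(s)x)=e^{\mu s}\mathbf d(s)f_\sigma(x)$ for all $\sigma,s,x$, and, whenever $x(\cdot)$ is a solution under the switching signal $\sigma(\cdot)$, $t\mapsto\mathbf d(s)x(e^{\mu s}t)$ is the unique solution that starts at $\mathbf d(s)x(0)$ under the signal $t\mapsto\sigma(e^{\mu s}t)$. * Let $\tau>0$ and consider all switching signals whose switching instants satisfy $\inf_i(t_{i+1}-t_i)\ge\tau$. If $\mu\in[-1,0)$, the origin is locally finite-time stable: it is Lyapunov stable, and there are $r>0$ and a finite settling-time function $T(\cdot)$ such that $|x(0)|<r$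 implies $x(t)=0$ for $t\ge T(x(0))$. If $\mu>0$, the system converges globally in fixed time to a compact set: there are a compact set $M$ and a time $T_{\max}$ such that all solutions satisfy $x(t)\in M$ for $t\ge T_{\max}$. The quantities $\delta(\varepsilon)$ of Lyapunov stability, $r$, $T(\cdot)$, $M$, $T_{\max}$ do not depend on the switching signal. * Let $\mu=0$, let $\gamma\ge1$ be any constant with $V_{\sigma'}(x)\le\gamma V_\sigma(x)$ for all $\sigma,\sigma',x$, let $\rho_{\min}=\min_\sigma\rho_\sigma$, $N_0\in\mathbb R$ and $\tau_d>\ln\gamma/\rho_{\min}$. Then the origin is globally uniformly exponentially stable over all switching signals whose number $N_\sigma(t,0)$ of switches in $(0,t]$ satisfies $N_\sigma(t,0)\le N_0+t/\tau_d$ for all $t\geq 0$: there are $C,\lambda>0$, independent of the switching signal, with $|x(t)|\le Ce^{-\lambda t}|x(0)|$ for all $t\ge0$ and all solutions. -/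

import Mathlib

open Set Filter Topology MeasureTheory Matrix

namespace HomSwitched

noncomputable section

/-! ### Matrices -/

/-- Kalman's rank condition: the matrix `[B, AB, …, A^(n-1)B]` has rank `n`. -/
def IsControllable {n m : ℕ} (A : Matrix (Fin n) (Fin n) ℝ) (B : Matrix (Fin n) (Fin m) ℝ) :
    Prop :=
  (Matrix.of fun (i : Fin n) (p : Fin n × Fin m) => (A ^ (p.1 : ℕ) * B) i p.2).rank = n

/-- All complex eigenvalues of the real matrix `M` have positive real part. -/
def IsAntiHurwitz {n : ℕ} (M : Matrix (Fin n) (Fin n) ℝ) : Prop :=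
  ∀ z ∈ spectrum ℂ (M.map (algebraMap ℝ ℂ)), 0 < z.re

/-! ### Linear dilations and canonical homogeneous norms -/

/-- The linear dilation `d(s) = exp (s G)` generated by the matrix `G`. -/
def dilation {n : ℕ} (G : Matrix (Fin n) (Fin n) ℝ) (s : ℝ) : Matrix (Fin n) (Fin n) ℝ :=
  NormedSpace.exp (s • G)

/-- The weighted Euclidean norm `√(xᵀ P x)`. -/
def weightedNorm {n : ℕ} (P : Matrix (Fin n) (Fin n) ℝ) (x : Fin n → ℝ) : ℝ :=
  √(x ⬝ᵥ (P *ᵥ x))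

open Classical in
/-- The canonical homogeneous norm induced by `√(xᵀ P x)`: its value at `x ≠ 0` is `exp s`, where
`s` is the real number with `‖d(-s) x‖_P = 1`; its value at `0` is `0` (no such `s` exists). -/
def canonicalNorm {n : ℕ} (G P : Matrix (Fin n) (Fin n) ℝ) (x : Fin n → ℝ) : ℝ :=
  if h : ∃ s : ℝ, weightedNorm P (dilation G (-s) *ᵥ x) = 1 then Real.exp h.choose else 0

/-- The homogeneous feedback `u(x) = K₀ x + V(x)^(1+μ) K d(-ln V(x)) x`, where `V` is the canonical
homogeneous norm induced by `√(xᵀ P x)`. -/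
def feedback {n m : ℕ} (K₀ K : Matrix (Fin m) (Fin n) ℝ) (G P : Matrix (Fin n) (Fin n) ℝ)
    (μ : ℝ) (x : Fin n → ℝ) : Fin m → ℝ :=
  K₀ *ᵥ x + (canonicalNorm G P x) ^ (1 + μ) •
    (K *ᵥ (dilation G (-Real.log (canonicalNorm G P x)) *ᵥ x))

/-- The vector field `A x + B u(x)` of one mode of the closed loop. -/
def closedLoop {n m : ℕ} (A : Matrix (Fin n) (Fin n) ℝ) (B : Matrix (Fin n) (Fin m) ℝ)
    (u : (Fin n → ℝ) → (Fin m → ℝ)) (x : Fin n → ℝ) : Fin n → ℝ :=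
  A *ᵥ x + B *ᵥ u x

/-- A vector field is `d`-homogeneous of degree `μ` if `φ (d(s) x) = e^(μ s) d(s) φ(x)`. -/
def IsHomogeneousField {n : ℕ} (G : Matrix (Fin n) (Fin n) ℝ) (μ : ℝ)
    (φ : (Fin n → ℝ) → (Fin n → ℝ)) : Prop :=
  ∀ (s : ℝ) (x : Fin n → ℝ),
    φ (dilation G s *ᵥ x) = Real.exp (μ * s) • (dilation G s *ᵥ φ x)

/-! ### Switching signals -/

/-- `σ` is a switching signal on `[0, ∞)`: right-continuous and piecewise constant, with finitely
many switches on each bounded interval. -/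
def IsSwitchingSignal {ι : Type*} (σ : ℝ → ι) : Prop :=
  (∀ t, 0 ≤ t → ∀ᶠ s in 𝓝[>] t, σ s = σ t) ∧
  (∀ t, 0 < t → ∃ i, ∀ᶠ s in 𝓝[<] t, σ s = i)

/-- The switching instants of `σ`: its discontinuity points in `(0, ∞)`. -/
def switchingTimes {ι : Type*} (σ : ℝ → ι) : Set ℝ :=
  {t | 0 < t ∧ ¬ ∀ᶠ s in 𝓝[<] t, σ s = σ t}

/-- The number of switching instants of `σ` in `(t₀, t]`. -/
def numSwitches {ι : Type*} (σ : ℝ → ι) (t t₀ : ℝ) : ℕ :=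
  (switchingTimes σ ∩ Ioc t₀ t).ncard

/-- The switching signals any two switching instants of which are at least `τ` apart. -/
def minDwell (ι : Type*) (τ : ℝ) : Set (ℝ → ι) :=
  {σ | IsSwitchingSignal σ ∧
    ∀ t ∈ switchingTimes σ, ∀ t' ∈ switchingTimes σ, t < t' → τ ≤ t' - t}

/-- The switching signals with average dwell time `τd` and chatter bound `N₀`, counted from the
initial time `0`. -/
def averageDwell (ι : Type*) (N₀ τd : ℝ) : Set (ℝ → ι) :=
  {σ | IsSwitchingSignal σ ∧ ∀ t, 0 ≤ t → (numSwitches σ t 0 : ℝ) ≤ N₀ + t / τd}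

/-! ### Solutions of switched systems -/

/-- Filippov's set-valued regularization of a vector field. -/
def filippov {n : ℕ} (f : (Fin n → ℝ) → (Fin n → ℝ)) (x : Fin n → ℝ) : Set (Fin n → ℝ) :=
  ⋂ (δ : ℝ) (_ : 0 < δ) (Z : Set (Fin n → ℝ)) (_ : volume Z = 0),
    closure (convexHull ℝ (f '' (Metric.ball x δ \ Z)))

/-- `x` is, on `[0, T]`, a Filippov solution of `x' = f_{σ(t)}(x)`: an absolutely continuous
function (written as the integral of its derivative `v`) with `x'(t) ∈ F[f_{σ(t)}](x(t))` for
almost all `t`. -/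
def IsSolution {n : ℕ} {ι : Type*} (f : ι → (Fin n → ℝ) → (Fin n → ℝ)) (σ : ℝ → ι)
    (T : ℝ) (x : ℝ → (Fin n → ℝ)) : Prop :=
  0 ≤ T ∧ ∃ v : ℝ → (Fin n → ℝ), IntervalIntegrable v volume 0 T ∧
    (∀ t ∈ Icc 0 T, x t = x 0 + ∫ s in (0 : ℝ)..t, v s) ∧
    ∀ᵐ t ∂(volume.restrict (Icc 0 T)), v t ∈ filippov (f (σ t)) (x t)

/-- The switched system `x' = f_{σ(t)}(x)` is `d`-homogeneous of degree `μ`: for all `s`, all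
switching signals `σ` and all solutions `x`, the function `t ↦ d(s) x(e^(μ s) t)` is the one and
only solution that starts at `d(s) x(0)` under the rescaled signal `t ↦ σ(e^(μ s) t)`. Solutions
are taken on arbitrary bounded intervals `[0, T]`. -/
def IsHomogeneousSwitched {n : ℕ} {ι : Type*} (G : Matrix (Fin n) (Fin n) ℝ) (μ : ℝ)
    (f : ι → (Fin n → ℝ) → (Fin n → ℝ)) : Prop :=
  ∀ (s : ℝ) (σ : ℝ → ι), IsSwitchingSignal σ →
    ∀ (T : ℝ) (x : ℝ → (Fin n → ℝ)), IsSolution f σ T x →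
      IsSolution f (fun t => σ (Real.exp (μ * s) * t)) (Real.exp (-(μ * s)) * T)
        (fun t => dilation G s *ᵥ x (Real.exp (μ * s) * t)) ∧
      ∀ y : ℝ → (Fin n → ℝ),
        IsSolution f (fun t => σ (Real.exp (μ * s) * t)) (Real.exp (-(μ * s)) * T) y →
        y 0 = dilation G s *ᵥ x 0 →
        ∀ t ∈ Icc 0 (Real.exp (-(μ * s)) * T), y t = dilation G s *ᵥ x (Real.exp (μ * s) * t)

/-! ### Stability notions, uniform over a class `S` of switching signals

They concern every solution on every interval `[0, T]`, hence also all solutions on `[0, ∞)`; none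
of them depends on the choice of the norm of `ℝⁿ`. -/

/-- The origin is locally finite-time stable: Lyapunov stable, and all solutions that start in some
neighbourhood of the origin are zero from a finite settling time `Ts (x 0)` on. -/
def IsLocallyFiniteTimeStable {n : ℕ} {ι : Type*} (f : ι → (Fin n → ℝ) → (Fin n → ℝ))
    (S : Set (ℝ → ι)) : Prop :=
  (∀ ε > 0, ∃ δ > 0, ∀ σ ∈ S, ∀ (T : ℝ) (x : ℝ → (Fin n → ℝ)), IsSolution f σ T x →
    ‖x 0‖ < δ → ∀ t ∈ Icc 0 T, ‖x t‖ < ε) ∧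
  (∃ r > 0, ∃ Ts : (Fin n → ℝ) → ℝ, ∀ σ ∈ S, ∀ (T : ℝ) (x : ℝ → (Fin n → ℝ)),
    IsSolution f σ T x → ‖x 0‖ < r → ∀ t ∈ Icc 0 T, Ts (x 0) ≤ t → x t = 0)

/-- The set `M` is globally fixed-time attractive: all solutions are in `M` from a time `Tmax` on
that does not depend on the initial state. -/
def IsFixedTimeAttractive {n : ℕ} {ι : Type*} (f : ι → (Fin n → ℝ) → (Fin n → ℝ))
    (S : Set (ℝ → ι)) (M : Set (Fin n → ℝ)) : Prop :=
  ∃ Tmax : ℝ, ∀ σ ∈ S, ∀ (T : ℝ) (x : ℝ → (Fin n → ℝ)), IsSolution f σ T x →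
    ∀ t ∈ Icc 0 T, Tmax ≤ t → x t ∈ M

/-- The origin is globally uniformly exponentially stable. -/
def IsGloballyExponentiallyStable {n : ℕ} {ι : Type*} (f : ι → (Fin n → ℝ) → (Fin n → ℝ))
    (S : Set (ℝ → ι)) : Prop :=
  ∃ C > 0, ∃ lam > 0, ∀ σ ∈ S, ∀ (T : ℝ) (x : ℝ → (Fin n → ℝ)), IsSolution f σ T x →
    ∀ t ∈ Icc 0 T, ‖x t‖ ≤ C * Real.exp (-lam * t) * ‖x 0‖

end

end HomSwitched

/-!
The proof follows one trajectory through the Lyapunov functions of the active modes.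

*Homogenization.* A covector `w` with `w (G₀ - 1) = 0` generates left eigenvectors `w Aᵏ` of `G₀`
with the eigenvalues `k + 1 ≠ 0`; as `G₀ B = 0`, they all annihilate `B`, so controllability forces
`w = 0` (`isUnit_sub_one_of_controllable`). The linear equations then become the intertwining
relations `A₀ Gd = (Gd + μ) A₀` and `Gd B = B`, which exponentiate to the homogeneity of the
closed loop (`isHomogeneousField_modeField`).

*The canonical homogeneous norm.* For `P = X⁻¹` the inequality `Gd X + X Gdᵀ ≻ 0` says that
`s ↦ ‖d(-s) x‖²` decreases strictly, at an exponential rate. Hence it takes the value `1` exactly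
once, and the implicit function theorem makes `log V` a `C¹` function off the origin
(`IsStrictlyMonotone.contDiffAt_log_canonicalNorm`). Sublevel sets of `V` are linear images of
sublevel sets of the weighted norm, which gives continuity at the origin and compactness. By
homogeneity the decay `V' ≤ -ρ V ^ (1 + μ)` has to be checked on `V = 1` only, where the closed loop
is linear and the estimate is the linear matrix inequality (`fderiv_canonicalNorm_modeField_le`).

*Trajectories.* Off the origin the modes are `C¹`, so Filippov's regularization is single-valued and
solutions are classical from the right (`IsSolution.hasDerivWithinAt`). At the origin nothing has to
be known about the regularization: `V` cannot grow away from `0`, so the origin is absorbing. This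
and local Lipschitz continuity give uniqueness (`IsSolution.eqOn`). Along a single mode,
`V ^ (-μ) / μ` grows at least at the rate `ρ`; for `μ < 0` this means extinction in finite time, for
`μ > 0` a bound after any given time that does not depend on the initial state, and for `μ = 0` the
corresponding estimate is exponential decay.

*Switching.* At a switching instant the value of the active Lyapunov function grows at most by the
factor `γ`. Under a minimum dwell time `τ` some mode is active for the time `τ` within any time
interval of length `2 τ`, which suffices for `μ ≠ 0` (`IsSolution.le_and_eq_zero_of_minDwell`,
`IsSolution.exists_le_of_minDwell`). Under an average dwell time the factors `γ` are counted
(`IsSolution.le_pow_numSwitches_mul`) and lose against the decay because `log γ < ρ_min τd`.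
-/

namespace HomSwitched

/-! ### Homogenization of a controllable pair -/

/-- A covector that annihilates the whole Kalman matrix vanishes. -/
lemma IsControllable.eq_zero_of_vecMul {n m : ℕ} {A : Matrix (Fin n) (Fin n) ℝ}
    {B : Matrix (Fin n) (Fin m) ℝ} (hAB : IsControllable A B) {w : Fin n → ℝ}
    (hw : ∀ k : ℕ, w ᵥ* (A ^ k * B) = 0) : w = 0 := by
  set C : Matrix (Fin n) (Fin n × Fin m) ℝ :=
    Matrix.of fun (i : Fin n) (p : Fin n × Fin m) => (A ^ (p.1 : ℕ) * B) i p.2 with hC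
  have hrank : C.rank = n := hAB
  have hli : LinearIndependent ℝ C.row := by
    rw [linearIndependent_iff_card_eq_finrank_span, Set.finrank, ← C.rank_eq_finrank_span_row,
      hrank, Fintype.card_fin]
  have hinj : Function.Injective C.vecMul := Matrix.vecMul_injective_iff.2 hli
  apply hinj
  ext p
  simpa [Matrix.vecMul, dotProduct, hC] using congrFun (hw p.1) p.2

section Homogenization

variable {n m : ℕ} {A : Matrix (Fin n) (Fin n) ℝ} {B : Matrix (Fin n) (Fin m) ℝ}
  {G₀ : Matrix (Fin n) (Fin n) ℝ} {Y₀ : Matrix (Fin m) (Fin n) ℝ}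

/-- If `w (G₀ - 1) = 0`, then `w Aᵏ` is a left eigenvector of `G₀` for the eigenvalue `k + 1 ≠ 0`,
so it annihilates `B`; controllability gives `w = 0`. -/
lemma isUnit_sub_one_of_controllable (hAB : IsControllable A B)
    (hY₀ : A * G₀ - G₀ * A + B * Y₀ = A) (hG₀ : G₀ * B = 0) : IsUnit (G₀ - 1) := by
  rw [← Matrix.vecMul_injective_iff_isUnit]
  refine (injective_iff_map_eq_zero (Matrix.vecMulLinear (G₀ - 1))).2 fun w hw => ?_
  replace hw : w ᵥ* (G₀ - 1) = 0 := hw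
  rw [Matrix.vecMul_sub, Matrix.vecMul_one, sub_eq_zero] at hw
  have hB : ∀ k : ℕ, (w ᵥ* A ^ k) ᵥ* G₀ = ((k : ℝ) + 1) • (w ᵥ* A ^ k) →
      (w ᵥ* A ^ k) ᵥ* B = 0 := by
    intro k hk
    have h1 : ((w ᵥ* A ^ k) ᵥ* G₀) ᵥ* B = 0 := by
      rw [Matrix.vecMul_vecMul, hG₀, Matrix.vecMul_zero]
    rw [hk, Matrix.smul_vecMul] at h1
    exact (smul_eq_zero.1 h1).resolve_left (by positivity)
  have heig : ∀ k : ℕ, (w ᵥ* A ^ k) ᵥ* G₀ = ((k : ℝ) + 1) • (w ᵥ* A ^ k) := by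
    intro k
    induction k with
    | zero => simpa using hw
    | succ k ih =>
      have h1 : A * G₀ = A + G₀ * A - B * Y₀ := by
        rw [← sub_eq_zero, ← sub_eq_zero.2 hY₀]; abel
      have h2 := hB k ih
      have h3 : (w ᵥ* A ^ (k + 1)) ᵥ* G₀ = (w ᵥ* A ^ k) ᵥ* (A * G₀) := by
        simp only [Matrix.vecMul_vecMul, pow_succ, Matrix.mul_assoc]
      rw [h3, h1, Matrix.vecMul_sub, Matrix.vecMul_add, ← Matrix.vecMul_vecMul _ G₀,
        ← Matrix.vecMul_vecMul _ B, h2, ih, Matrix.smul_vecMul, Matrix.zero_vecMul, sub_zero,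
        Matrix.vecMul_vecMul, ← pow_succ]
      push_cast
      module
  refine hAB.eq_zero_of_vecMul fun k => ?_
  rw [← Matrix.vecMul_vecMul]
  exact hB k (heig k)

lemma homogenized_mul_dilation_generator (hunit : IsUnit (G₀ - 1))
    (hY₀ : A * G₀ - G₀ * A + B * Y₀ = A) (hG₀ : G₀ * B = 0) (μ : ℝ) :
    (A + B * (Y₀ * (G₀ - 1)⁻¹)) * (1 + μ • G₀) =
      ((1 + μ • G₀) + μ • 1) * (A + B * (Y₀ * (G₀ - 1)⁻¹)) := by
  set Z := Y₀ * (G₀ - 1)⁻¹ with hZ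
  have hZ1 : Z * G₀ = Y₀ + Z := by
    have : Z * (G₀ - 1) = Y₀ := by
      rw [hZ, Matrix.mul_assoc, Matrix.nonsing_inv_mul _ ((Matrix.isUnit_iff_isUnit_det _).1 hunit),
        Matrix.mul_one]
    rw [Matrix.mul_sub, Matrix.mul_one] at this
    rw [← this]; abel
  have hA1 : A * G₀ = A + G₀ * A - B * Y₀ := by
    rw [← sub_eq_zero, ← sub_eq_zero.2 hY₀]; abel
  have key : (A + B * Z) * G₀ = G₀ * (A + B * Z) + (A + B * Z) := by
    rw [Matrix.add_mul, Matrix.mul_add, Matrix.mul_assoc, hZ1, hA1, ← Matrix.mul_assoc G₀ B, hG₀,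
      Matrix.zero_mul, Matrix.mul_add]
    abel
  rw [Matrix.mul_add, Matrix.mul_smul, key]
  simp only [Matrix.add_mul, Matrix.smul_mul, Matrix.one_mul, Matrix.mul_one]
  module

end Homogenization

open scoped Matrix.Norms.Operator in
lemma isAntiHurwitz_one_add_smul {n : ℕ} (G : Matrix (Fin n) (Fin n) ℝ) :
    ∃ ε > 0, ∀ ν : ℝ, |ν| < ε → IsAntiHurwitz (1 + ν • G) := by
  set H : Matrix (Fin n) (Fin n) ℂ := G.map (algebraMap ℝ ℂ) with hH
  set c : ℝ := ‖H‖ * ‖(1 : Matrix (Fin n) (Fin n) ℂ)‖ with hc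
  have hc0 : 0 ≤ c := by positivity
  refine ⟨1 / (c + 1), by positivity, fun ν hν z hz => ?_⟩
  have h1 : (1 + ν • G).map (algebraMap ℝ ℂ) =
      algebraMap ℂ (Matrix (Fin n) (Fin n) ℂ) 1 + (ν : ℂ) • H := by
    ext i j
    by_cases hij : i = j <;> simp [hH, hij]
  have hz : z - 1 ∈ spectrum ℂ ((ν : ℂ) • H) := by
    rwa [h1, ← sub_add_cancel z 1, spectrum.add_mem_add_iff] at hz
  have h2 : ‖z - 1‖ ≤ |ν| * c := by
    refine (spectrum.norm_le_norm_mul_of_mem hz).trans ?_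
    rw [norm_smul, mul_assoc]
    simp [hc]
  have h3 : |ν| * c < 1 := by
    rw [lt_div_iff₀ (by positivity)] at hν
    nlinarith [abs_nonneg ν]
  have h4 := (Complex.abs_re_le_norm (z - 1)).trans_lt (h2.trans_lt h3)
  rw [abs_lt] at h4
  simp only [Complex.sub_re, Complex.one_re] at h4
  linarith [h4.1]

/-! ### Linear dilations -/

section Dilation

variable {n : ℕ} (G : Matrix (Fin n) (Fin n) ℝ)

@[simp] lemma dilation_zero : dilation G 0 = 1 := by simp [dilation]

lemma dilation_add (s t : ℝ) : dilation G (s + t) = dilation G s * dilation G t := by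
  rw [dilation, add_smul, Matrix.exp_add_of_commute]
  · rfl
  · exact ((Commute.refl G).smul_left s).smul_right t

lemma dilation_mulVec_mulVec (s t : ℝ) (x : Fin n → ℝ) :
    dilation G s *ᵥ (dilation G t *ᵥ x) = dilation G (s + t) *ᵥ x := by
  rw [Matrix.mulVec_mulVec, dilation_add]

lemma dilation_mulVec_eq_zero {s : ℝ} {x : Fin n → ℝ} : dilation G s *ᵥ x = 0 ↔ x = 0 := by
  refine ⟨fun h => ?_, fun h => by simp [h]⟩
  have := dilation_mulVec_mulVec G (-s) s x
  rwa [h, Matrix.mulVec_zero, neg_add_cancel, dilation_zero, Matrix.one_mulVec, eq_comm] at this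

lemma exp_smul_one (s : ℝ) :
    NormedSpace.exp (s • (1 : Matrix (Fin n) (Fin n) ℝ)) = Real.exp s • 1 := by
  rw [Matrix.smul_one_eq_diagonal, Matrix.exp_diagonal, Matrix.smul_one_eq_diagonal]
  congr 1
  ext i
  rw [Pi.exp_def, Real.exp_eq_exp_ℝ]

@[simp] lemma dilation_one (s : ℝ) :
    dilation (1 : Matrix (Fin n) (Fin n) ℝ) s = Real.exp s • 1 := exp_smul_one s

variable {G}

open scoped Matrix.Norms.Operator in
/-- Conjugation by exponentials turns `C G = H C` into `C exp(s G) = exp(s H) C`. -/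
lemma mul_dilation_of_mul_eq {C H : Matrix (Fin n) (Fin n) ℝ} (h : C * G = H * C) (s : ℝ) :
    C * dilation G s = dilation H s * C := by
  have : SemiconjBy C (s • G) (s • H) := by
    rw [SemiconjBy, Matrix.mul_smul, h, Matrix.smul_mul]
  exact this.exp_right

lemma dilation_add_smul_one (μ s : ℝ) :
    dilation (G + μ • 1) s = Real.exp (μ * s) • dilation G s := by
  rw [dilation, smul_add, Matrix.exp_add_of_commute, smul_smul, mul_comm s μ, exp_smul_one,
    Matrix.mul_smul, Matrix.mul_one]
  · rfl
  · exact (((Commute.one_right G).smul_right μ).smul_left s).smul_right s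

variable (G)

open scoped Matrix.Norms.Operator in
lemma hasDerivAt_dilation_apply (i j : Fin n) (s : ℝ) :
    HasDerivAt (fun s => dilation G s i j) ((G * dilation G s) i j) s := by
  have h : HasDerivAt (fun u : ℝ => NormedSpace.exp (u • G)) (G * NormedSpace.exp (s • G)) s :=
    hasDerivAt_exp_smul_const' G s
  exact hasDerivAt_pi.1 (hasDerivAt_pi.1 h i) j

lemma continuous_dilation_apply (i j : Fin n) : Continuous fun s => dilation G s i j :=
  continuous_iff_continuousAt.2 fun s => (hasDerivAt_dilation_apply G i j s).continuousAt

lemma contDiff_dilation_apply (i j : Fin n) : ContDiff ℝ 1 fun s => dilation G s i j := by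
  rw [contDiff_one_iff_deriv]
  refine ⟨fun s => (hasDerivAt_dilation_apply G i j s).differentiableAt, ?_⟩
  have : deriv (fun s => dilation G s i j) = fun s => ∑ k, G i k * dilation G s k j := by
    funext s
    rw [(hasDerivAt_dilation_apply G i j s).deriv, Matrix.mul_apply]
  rw [this]
  exact continuous_finsetSum _ fun k _ => continuous_const.mul (continuous_dilation_apply G k j)

lemma contDiff_dilation_mulVec :
    ContDiff ℝ 1 fun p : ℝ × (Fin n → ℝ) => dilation G p.1 *ᵥ p.2 := by
  rw [contDiff_pi]
  intro i
  simp only [Matrix.mulVec, dotProduct]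
  refine ContDiff.sum fun j _ => ?_
  exact ((contDiff_dilation_apply G i j).comp contDiff_fst).mul
    ((contDiff_apply ℝ ℝ j).comp contDiff_snd)

/-- The product rule for `d(a(t)) y(t)`. -/
lemma hasDerivAt_dilation_mulVec {a : ℝ → ℝ} {y : ℝ → Fin n → ℝ} {a' t : ℝ} {y' : Fin n → ℝ}
    (ha : HasDerivAt a a' t) (hy : HasDerivAt y y' t) :
    HasDerivAt (fun t => dilation G (a t) *ᵥ y t)
      (a' • (G *ᵥ (dilation G (a t) *ᵥ y t)) + dilation G (a t) *ᵥ y') t := by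
  rw [hasDerivAt_pi]
  intro i
  have h := HasDerivAt.fun_sum (u := Finset.univ) fun j _ =>
    ((hasDerivAt_dilation_apply G i j (a t)).comp t ha).mul (hasDerivAt_pi.1 hy j)
  refine h.congr_deriv ?_
  rw [Matrix.mulVec_mulVec, Pi.add_apply, Pi.smul_apply, Matrix.mulVec, dotProduct,
    Matrix.mulVec, dotProduct, smul_eq_mul, Finset.mul_sum, ← Finset.sum_add_distrib]
  refine Finset.sum_congr rfl fun j _ => ?_
  simp only [Function.comp_apply]
  ring

lemma continuous_mulVec_const {k l : ℕ} (M : Matrix (Fin k) (Fin l) ℝ) :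
    Continuous fun x : Fin l → ℝ => M *ᵥ x :=
  Continuous.matrix_mulVec continuous_const continuous_id

end Dilation

/-! ### Quadratic forms -/

section QuadraticForm

variable {n : ℕ}

lemma continuous_quadForm (P : Matrix (Fin n) (Fin n) ℝ) :
    Continuous fun x : Fin n → ℝ => x ⬝ᵥ (P *ᵥ x) :=
  continuous_id.dotProduct (continuous_mulVec_const P)

lemma quadForm_smul (P : Matrix (Fin n) (Fin n) ℝ) (c : ℝ) (x : Fin n → ℝ) :
    (c • x) ⬝ᵥ (P *ᵥ (c • x)) = c ^ 2 * (x ⬝ᵥ (P *ᵥ x)) := by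
  rw [Matrix.mulVec_smul, smul_dotProduct, dotProduct_smul, smul_eq_mul, smul_eq_mul]
  ring

/-- Minimum over the unit sphere of a form that is positive off the origin. -/
lemma exists_mul_norm_sq_le_quadForm {P : Matrix (Fin n) (Fin n) ℝ}
    (hP : ∀ x, x ≠ 0 → 0 < x ⬝ᵥ (P *ᵥ x)) :
    ∃ c > 0, ∀ x : Fin n → ℝ, c * ‖x‖ ^ 2 ≤ x ⬝ᵥ (P *ᵥ x) := by
  obtain ⟨c, hc, hmin⟩ : ∃ c > 0, ∀ y ∈ Metric.sphere (0 : Fin n → ℝ) 1, c ≤ y ⬝ᵥ (P *ᵥ y) := by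
    rcases (Metric.sphere (0 : Fin n → ℝ) 1).eq_empty_or_nonempty with h | h
    · exact ⟨1, one_pos, by simp [h]⟩
    · obtain ⟨y, hy, hmin⟩ := (isCompact_sphere (0 : Fin n → ℝ) 1).exists_isMinOn h
        (continuous_quadForm P).continuousOn
      exact ⟨_, hP y (ne_zero_of_mem_unit_sphere ⟨y, hy⟩), fun z hz => hmin hz⟩
  refine ⟨c, hc, fun x => ?_⟩
  rcases eq_or_ne x 0 with rfl | hx
  · simp
  have hx' : 0 < ‖x‖ := norm_pos_iff.2 hx
  have h1 := hmin (‖x‖⁻¹ • x) (by simp [norm_smul, hx'.ne'])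
  rw [quadForm_smul, inv_pow, ← div_eq_inv_mul, le_div_iff₀ (by positivity)] at h1
  exact h1

lemma exists_quadForm_le_mul_norm_sq (P : Matrix (Fin n) (Fin n) ℝ) :
    ∃ c > 0, ∀ x : Fin n → ℝ, x ⬝ᵥ (P *ᵥ x) ≤ c * ‖x‖ ^ 2 := by
  obtain ⟨c, hc⟩ := (isCompact_sphere (0 : Fin n → ℝ) 1).exists_bound_of_continuousOn
    (continuous_quadForm P).continuousOn
  refine ⟨|c| + 1, by positivity, fun x => ?_⟩
  rcases eq_or_ne x 0 with rfl | hx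
  · simp
  have hx' : 0 < ‖x‖ := norm_pos_iff.2 hx
  have h1 := (le_abs_self _).trans (hc (‖x‖⁻¹ • x) (by simp [norm_smul, hx'.ne']))
  rw [quadForm_smul, inv_pow, ← div_eq_inv_mul, div_le_iff₀ (by positivity)] at h1
  nlinarith [le_abs_self c, sq_nonneg ‖x‖]

lemma hasDerivAt_quadForm {P : Matrix (Fin n) (Fin n) ℝ} (hP : P.IsHermitian)
    {z : ℝ → Fin n → ℝ} {z' : Fin n → ℝ} {t : ℝ} (hz : HasDerivAt z z' t) :
    HasDerivAt (fun t => z t ⬝ᵥ (P *ᵥ z t)) (2 * (z t ⬝ᵥ (P *ᵥ z'))) t := by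
  have h1 : HasDerivAt (fun t => P *ᵥ z t) (P *ᵥ z') t := by
    rw [hasDerivAt_pi]
    intro i
    simp only [Matrix.mulVec, dotProduct]
    exact HasDerivAt.fun_sum fun j _ => (hasDerivAt_pi.1 hz j).const_mul (P i j)
  have h2 := HasDerivAt.fun_sum (u := Finset.univ) fun j _ =>
    (hasDerivAt_pi.1 hz j).mul (hasDerivAt_pi.1 h1 j)
  refine h2.congr_deriv ?_
  have hsymm : z' ⬝ᵥ (P *ᵥ z t) = z t ⬝ᵥ (P *ᵥ z') := by
    rw [Matrix.dotProduct_mulVec, ← Matrix.mulVec_transpose, dotProduct_comm]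
    congr 2
  rw [Finset.sum_add_distrib]
  change z' ⬝ᵥ (P *ᵥ z t) + z t ⬝ᵥ (P *ᵥ z') = _
  rw [hsymm]
  ring

lemma contDiff_quadForm (P : Matrix (Fin n) (Fin n) ℝ) {k : WithTop ℕ∞} :
    ContDiff ℝ k fun x : Fin n → ℝ => x ⬝ᵥ (P *ᵥ x) := by
  simp only [dotProduct, Matrix.mulVec]
  fun_prop

lemma weightedNorm_eq_one_iff {P : Matrix (Fin n) (Fin n) ℝ} {x : Fin n → ℝ} :
    weightedNorm P x = 1 ↔ x ⬝ᵥ (P *ᵥ x) = 1 := by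
  rw [weightedNorm, Real.sqrt_eq_one]

end QuadraticForm

/-! ### The canonical homogeneous norm -/

/-- The dilation `exp (s G)` is strictly monotone with respect to the weighted norm of a positive
definite `P`: the generator `G` is strictly accretive for the inner product `xᵀ P y`. -/
structure IsStrictlyMonotone {n : ℕ} (G P : Matrix (Fin n) (Fin n) ℝ) : Prop where
  isHermitian : P.IsHermitian
  pos : ∀ x, x ≠ 0 → 0 < x ⬝ᵥ (P *ᵥ x)
  accretive : ∀ x, x ≠ 0 → 0 < x ⬝ᵥ (P *ᵥ (G *ᵥ x))

lemma isStrictlyMonotone_inv {n : ℕ} {G X : Matrix (Fin n) (Fin n) ℝ} (hX : X.PosDef)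
    (hGX : (G * X + X * Gᵀ).PosDef) : IsStrictlyMonotone G X⁻¹ := by
  have hunit : IsUnit X.det := (Matrix.isUnit_iff_isUnit_det _).1 hX.isUnit
  have hP : (X⁻¹).PosDef := hX.inv
  refine ⟨hP.isHermitian, fun x hx => by simpa using hP.dotProduct_mulVec_pos hx, fun x hx => ?_⟩
  set w := X⁻¹ *ᵥ x with hw
  have hxw : X *ᵥ w = x := by
    rw [hw, Matrix.mulVec_mulVec, Matrix.mul_nonsing_inv _ hunit, Matrix.one_mulVec]
  have hw0 : w ≠ 0 := by
    rintro h
    rw [h, Matrix.mulVec_zero] at hxw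
    exact hx hxw.symm
  have hXt : Xᵀ = X := by simpa using hX.isHermitian.eq
  have hPt : (X⁻¹)ᵀ = X⁻¹ := by simpa using hP.isHermitian.eq
  have h1 := hGX.dotProduct_mulVec_pos hw0
  rw [star_trivial, Matrix.add_mulVec, dotProduct_add] at h1
  have h2 : w ⬝ᵥ ((G * X) *ᵥ w) = x ⬝ᵥ (X⁻¹ *ᵥ (G *ᵥ x)) := by
    rw [← Matrix.mulVec_mulVec, hxw, Matrix.dotProduct_mulVec x, ← Matrix.mulVec_transpose, hPt]
  have h3 : w ⬝ᵥ ((X * Gᵀ) *ᵥ w) = x ⬝ᵥ (X⁻¹ *ᵥ (G *ᵥ x)) := by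
    rw [← h2, Matrix.dotProduct_mulVec, ← Matrix.mulVec_transpose, Matrix.transpose_mul,
      Matrix.transpose_transpose, hXt, dotProduct_comm]
  rw [h2, h3] at h1
  linarith

section CanonicalNorm

variable {n : ℕ} {G P : Matrix (Fin n) (Fin n) ℝ}

/-- The squared weighted norm `‖d(-s) x‖²`, as a function of the point `x` and of `s`. -/
noncomputable def dilatedForm (G P : Matrix (Fin n) (Fin n) ℝ) (x : Fin n → ℝ) (s : ℝ) : ℝ :=
  (dilation G (-s) *ᵥ x) ⬝ᵥ (P *ᵥ (dilation G (-s) *ᵥ x))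

@[simp] lemma dilatedForm_zero_left (s : ℝ) : dilatedForm G P 0 s = 0 := by simp [dilatedForm]

lemma dilatedForm_dilation (x : Fin n → ℝ) (s t : ℝ) :
    dilatedForm G P (dilation G t *ᵥ x) s = dilatedForm G P x (s - t) := by
  rw [dilatedForm, dilation_mulVec_mulVec, dilatedForm, neg_add_eq_sub, neg_sub]

lemma contDiff_dilatedForm :
    ContDiff ℝ 1 fun p : (Fin n → ℝ) × ℝ => dilatedForm G P p.1 p.2 :=
  (contDiff_quadForm P).comp
    ((contDiff_dilation_mulVec G).comp (contDiff_snd.neg.prodMk contDiff_fst))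

lemma continuous_dilatedForm_left (s : ℝ) : Continuous fun x => dilatedForm G P x s :=
  (contDiff_dilatedForm (G := G) (P := P)).continuous.comp (continuous_id.prodMk continuous_const)

lemma continuous_dilatedForm_right (x : Fin n → ℝ) : Continuous (dilatedForm G P x) :=
  (contDiff_dilatedForm (G := G) (P := P)).continuous.comp (continuous_const.prodMk continuous_id)

@[simp] lemma canonicalNorm_zero : canonicalNorm G P 0 = 0 := by
  rw [canonicalNorm, dif_neg]
  simp [weightedNorm]

namespace IsStrictlyMonotone

variable (h : IsStrictlyMonotone G P)

include h

lemma dilatedForm_pos {x : Fin n → ℝ} (hx : x ≠ 0) (s : ℝ) : 0 < dilatedForm G P x s :=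
  h.pos _ (mt (dilation_mulVec_eq_zero G).1 hx)

lemma hasDerivAt_dilatedForm (x : Fin n → ℝ) (s : ℝ) :
    HasDerivAt (dilatedForm G P x)
      (-2 * ((dilation G (-s) *ᵥ x) ⬝ᵥ (P *ᵥ (G *ᵥ (dilation G (-s) *ᵥ x))))) s := by
  have h1 := hasDerivAt_dilation_mulVec G (hasDerivAt_id s).neg (hasDerivAt_const s x)
  refine (hasDerivAt_quadForm h.isHermitian h1).congr_deriv ?_
  simp [Matrix.mulVec_neg, dotProduct_neg]

lemma strictAnti_dilatedForm {x : Fin n → ℝ} (hx : x ≠ 0) : StrictAnti (dilatedForm G P x) := by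
  refine strictAnti_of_deriv_neg fun s => ?_
  rw [(h.hasDerivAt_dilatedForm x s).deriv]
  have := h.accretive _ (mt (dilation_mulVec_eq_zero G (s := -s)).1 hx)
  linarith

/-- The form decays at an exponential rate along the dilation. -/
lemma exists_antitone_dilatedForm :
    ∃ α > 0, ∀ x, Antitone fun s => dilatedForm G P x s * Real.exp (2 * α * s) := by
  have hacc : ∀ x, x ≠ 0 → 0 < x ⬝ᵥ ((P * G) *ᵥ x) := fun x hx => by
    rw [← Matrix.mulVec_mulVec]; exact h.accretive x hx
  obtain ⟨c, hc, hcle⟩ := exists_mul_norm_sq_le_quadForm hacc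
  obtain ⟨C, hC, hleC⟩ := exists_quadForm_le_mul_norm_sq P
  refine ⟨c / C, by positivity, fun x => ?_⟩
  have hd : ∀ s, HasDerivAt (fun s => dilatedForm G P x s * Real.exp (2 * (c / C) * s))
      ((-2 * ((dilation G (-s) *ᵥ x) ⬝ᵥ (P *ᵥ (G *ᵥ (dilation G (-s) *ᵥ x))))) *
        Real.exp (2 * (c / C) * s) +
      dilatedForm G P x s * (Real.exp (2 * (c / C) * s) * (2 * (c / C)))) s := fun s =>
    (h.hasDerivAt_dilatedForm x s).mul
      ((by simpa using (hasDerivAt_id s).const_mul (2 * (c / C)) :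
        HasDerivAt (fun s => 2 * (c / C) * s) (2 * (c / C)) s).exp)
  refine antitone_of_deriv_nonpos (fun s => (hd s).differentiableAt) fun s => ?_
  rw [(hd s).deriv]
  set z := dilation G (-s) *ᵥ x with hz
  have h1 := hcle z
  have h2 := hleC z
  rw [← Matrix.mulVec_mulVec] at h1
  have h3 : (c / C) * dilatedForm G P x s ≤ c * ‖z‖ ^ 2 := by
    rw [div_mul_eq_mul_div, div_le_iff₀ hC, mul_assoc, mul_comm (‖z‖ ^ 2)]
    exact mul_le_mul_of_nonneg_left h2 hc.le
  nlinarith [Real.exp_pos (2 * (c / C) * s)]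

lemma existsUnique_dilatedForm_eq_one {x : Fin n → ℝ} (hx : x ≠ 0) :
    ∃! s, dilatedForm G P x s = 1 := by
  obtain ⟨α, hα, hanti⟩ := h.exists_antitone_dilatedForm
  set q := dilatedForm G P x 0 with hq
  have hq0 : 0 < q := h.dilatedForm_pos hx 0
  -- At `s₀` the exponential bound compares the form with `1`, from above or from below.
  set s₀ := Real.log q / (2 * α) with hs₀
  have hexp : Real.exp (2 * α * s₀) = q := by
    rw [hs₀, mul_div_cancel₀ _ (by positivity), Real.exp_log hq0]
  have hmem : (1 : ℝ) ∈ uIcc (dilatedForm G P x 0) (dilatedForm G P x s₀) := by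
    rw [mem_uIcc]
    rcases le_total 0 s₀ with h0 | h0
    · right
      have h1 := hanti x h0
      have h2 : 1 ≤ q := by
        rw [← hexp]; exact Real.one_le_exp (by positivity)
      simp only [hexp, mul_zero, Real.exp_zero, mul_one] at h1
      exact ⟨by rw [← hq] at h1; exact (mul_le_iff_le_one_left hq0).1 h1, h2⟩
    · left
      have h1 := hanti x h0
      have h2 : q ≤ 1 := by
        rw [← hexp]; exact Real.exp_le_one_iff.2 (mul_nonpos_of_nonneg_of_nonpos (by positivity) h0)
      simp only [hexp, mul_zero, Real.exp_zero, mul_one] at h1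
      exact ⟨h2, by rw [← hq] at h1; exact (le_mul_iff_one_le_left hq0).1 h1⟩
  obtain ⟨s, -, hs⟩ := intermediate_value_uIcc
    (continuous_dilatedForm_right (G := G) (P := P) x).continuousOn hmem
  exact ⟨s, hs, fun t ht => (h.strictAnti_dilatedForm hx).injective (ht.trans hs.symm)⟩

lemma exists_canonicalNorm_eq {x : Fin n → ℝ} (hx : x ≠ 0) :
    ∃ s, canonicalNorm G P x = Real.exp s ∧ dilatedForm G P x s = 1 := by
  obtain ⟨s, hs, -⟩ := h.existsUnique_dilatedForm_eq_one hx
  have hex : ∃ s : ℝ, weightedNorm P (dilation G (-s) *ᵥ x) = 1 :=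
    ⟨s, weightedNorm_eq_one_iff.2 hs⟩
  exact ⟨hex.choose, by rw [canonicalNorm, dif_pos hex],
    weightedNorm_eq_one_iff.1 hex.choose_spec⟩

lemma canonicalNorm_pos {x : Fin n → ℝ} (hx : x ≠ 0) : 0 < canonicalNorm G P x := by
  obtain ⟨s, hs, -⟩ := h.exists_canonicalNorm_eq hx
  exact hs ▸ Real.exp_pos s

lemma canonicalNorm_nonneg (x : Fin n → ℝ) : 0 ≤ canonicalNorm G P x := by
  rcases eq_or_ne x 0 with rfl | hx
  · simp
  · exact (h.canonicalNorm_pos hx).le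

lemma dilatedForm_log_canonicalNorm {x : Fin n → ℝ} (hx : x ≠ 0) :
    dilatedForm G P x (Real.log (canonicalNorm G P x)) = 1 := by
  obtain ⟨s, hs, h1⟩ := h.exists_canonicalNorm_eq hx
  rwa [hs, Real.log_exp]

lemma canonicalNorm_eq_exp_iff {x : Fin n → ℝ} (hx : x ≠ 0) {s : ℝ} :
    canonicalNorm G P x = Real.exp s ↔ dilatedForm G P x s = 1 := by
  obtain ⟨t, ht, h1⟩ := h.exists_canonicalNorm_eq hx
  rw [ht, Real.exp_eq_exp, ← h1, (h.strictAnti_dilatedForm hx).injective.eq_iff, eq_comm]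

lemma canonicalNorm_le_exp_iff (x : Fin n → ℝ) (s : ℝ) :
    canonicalNorm G P x ≤ Real.exp s ↔ dilatedForm G P x s ≤ 1 := by
  rcases eq_or_ne x 0 with rfl | hx
  · simp [Real.exp_nonneg]
  · obtain ⟨t, ht, h1⟩ := h.exists_canonicalNorm_eq hx
    rw [ht, Real.exp_le_exp, ← h1, (h.strictAnti_dilatedForm hx).le_iff_ge]

lemma canonicalNorm_lt_exp_iff (x : Fin n → ℝ) (s : ℝ) :
    canonicalNorm G P x < Real.exp s ↔ dilatedForm G P x s < 1 := by
  rcases eq_or_ne x 0 with rfl | hx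
  · simp [Real.exp_pos]
  · obtain ⟨t, ht, h1⟩ := h.exists_canonicalNorm_eq hx
    rw [ht, Real.exp_lt_exp, ← h1, (h.strictAnti_dilatedForm hx).lt_iff_gt]

lemma canonicalNorm_dilation (t : ℝ) (x : Fin n → ℝ) :
    canonicalNorm G P (dilation G t *ᵥ x) = Real.exp t * canonicalNorm G P x := by
  rcases eq_or_ne x 0 with rfl | hx
  · simp
  · obtain ⟨s, hs, h1⟩ := h.exists_canonicalNorm_eq hx
    rw [hs, ← Real.exp_add,
      h.canonicalNorm_eq_exp_iff (mt (dilation_mulVec_eq_zero G).1 hx), dilatedForm_dilation]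
    rwa [add_sub_cancel_left]

/-- `log V` solves `‖d(-s) x‖² = 1` for `s`, an equation that is `C¹` with nonzero derivative in
`s`. -/
lemma contDiffAt_log_canonicalNorm {x : Fin n → ℝ} (hx : x ≠ 0) :
    ContDiffAt ℝ 1 (fun y => Real.log (canonicalNorm G P y)) x := by
  set F : (Fin n → ℝ) × ℝ → ℝ := fun p => dilatedForm G P p.1 p.2 with hF
  set u : (Fin n → ℝ) × ℝ := (x, Real.log (canonicalNorm G P x)) with hu
  have hFu : F u = 1 := h.dilatedForm_log_canonicalNorm hx
  have hcd : ContDiffAt ℝ 1 F u := contDiff_dilatedForm.contDiffAt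
  set z := dilation G (-u.2) *ᵥ x with hz
  have hz0 : 0 < z ⬝ᵥ (P *ᵥ (G *ᵥ z)) := h.accretive _ (mt (dilation_mulVec_eq_zero G).1 hx)
  have hpart : (fderiv ℝ F u ∘L .inr ℝ (Fin n → ℝ) ℝ) 1 = -2 * (z ⬝ᵥ (P *ᵥ (G *ᵥ z))) := by
    have h1 : HasFDerivAt F (fderiv ℝ F u) (x, u.2) :=
      (hcd.differentiableAt (by simp)).hasFDerivAt
    have h2 : HasDerivAt (fun s : ℝ => (x, s)) ((0 : Fin n → ℝ), (1 : ℝ)) u.2 :=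
      (hasDerivAt_const _ _).prodMk (hasDerivAt_id _)
    exact (h1.comp_hasDerivAt u.2 h2).unique (h.hasDerivAt_dilatedForm x u.2)
  have hinv : (fderiv ℝ F u ∘L .inr ℝ (Fin n → ℝ) ℝ).IsInvertible := by
    have hne : (fderiv ℝ F u ∘L .inr ℝ (Fin n → ℝ) ℝ) 1 ≠ 0 := by rw [hpart]; linarith
    refine ⟨ContinuousLinearEquiv.unitsEquivAut ℝ (Units.mk0 _ hne), ?_⟩
    ext
    simp
  have hψ := hcd.contDiffAt_implicitFunction one_ne_zero hinv
  refine hψ.congr_of_eventuallyEq ?_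
  filter_upwards [hcd.eventually_apply_implicitFunction one_ne_zero hinv,
    isOpen_ne.mem_nhds hx] with y hy hy0
  rw [hFu] at hy
  rw [(h.canonicalNorm_eq_exp_iff hy0).2 hy, Real.log_exp]

lemma contDiffAt_canonicalNorm {x : Fin n → ℝ} (hx : x ≠ 0) :
    ContDiffAt ℝ 1 (canonicalNorm G P) x := by
  refine (h.contDiffAt_log_canonicalNorm hx).exp.congr_of_eventuallyEq ?_
  filter_upwards [isOpen_ne.mem_nhds hx] with y hy
  rw [Real.exp_log (h.canonicalNorm_pos hy)]

lemma continuous_canonicalNorm : Continuous (canonicalNorm G P) := by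
  rw [continuous_iff_continuousAt]
  intro x
  rcases eq_or_ne x 0 with rfl | hx
  · rw [ContinuousAt, canonicalNorm_zero, Metric.tendsto_nhds]
    intro ε hε
    have h1 : ∀ᶠ y in 𝓝 (0 : Fin n → ℝ), dilatedForm G P y (Real.log ε) < 1 :=
      (continuous_dilatedForm_left (Real.log ε)).continuousAt.eventually_lt continuousAt_const
        (by simp)
    filter_upwards [h1] with y hy
    rw [Real.dist_0_eq_abs, abs_of_nonneg (h.canonicalNorm_nonneg y), ← Real.exp_log hε]
    exact (h.canonicalNorm_lt_exp_iff y _).2 hy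
  · exact (h.contDiffAt_canonicalNorm hx).continuousAt

/-- Sublevel sets are linear images of sublevel sets of the weighted norm. -/
lemma isCompact_canonicalNorm_le (R : ℝ) : IsCompact {x | canonicalNorm G P x ≤ R} := by
  have hcl : IsClosed {x | canonicalNorm G P x ≤ R} :=
    isClosed_le h.continuous_canonicalNorm continuous_const
  set s := Real.log (max R 1) with hs
  have hR : R ≤ Real.exp s := by
    rw [hs, Real.exp_log (by positivity)]; exact le_max_left _ _
  obtain ⟨c, hc, hcle⟩ := exists_mul_norm_sq_le_quadForm h.pos
  refine ((isCompact_closedBall (0 : Fin n → ℝ) √(1 / c)).image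
    (continuous_mulVec_const (dilation G s))).of_isClosed_subset hcl fun x hx => ?_
  refine ⟨dilation G (-s) *ᵥ x, ?_, by
    beta_reduce
    rw [dilation_mulVec_mulVec, add_neg_cancel, dilation_zero, Matrix.one_mulVec]⟩
  rw [mem_closedBall_zero_iff]
  apply Real.le_sqrt_of_sq_le
  rw [le_div_iff₀' hc]
  exact (hcle _).trans ((h.canonicalNorm_le_exp_iff x s).1 (le_trans hx hR))

lemma tendsto_canonicalNorm_cocompact :
    Tendsto (canonicalNorm G P) (cocompact (Fin n → ℝ)) atTop := by
  rw [tendsto_atTop]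
  intro R
  filter_upwards [(h.isCompact_canonicalNorm_le R).compl_mem_cocompact] with x hx
  rw [mem_compl_iff, mem_ofPred_eq, not_le] at hx
  exact hx.le

/-- The derivative of the canonical homogeneous norm, by implicit differentiation of
`‖d(-s) x‖² = 1`. -/
lemma fderiv_canonicalNorm_apply {x : Fin n → ℝ} (hx : x ≠ 0) (v : Fin n → ℝ) {z : Fin n → ℝ}
    (hz : z = dilation G (-Real.log (canonicalNorm G P x)) *ᵥ x) :
    fderiv ℝ (canonicalNorm G P) x v = canonicalNorm G P x *
      ((z ⬝ᵥ (P *ᵥ (dilation G (-Real.log (canonicalNorm G P x)) *ᵥ v))) /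
        (z ⬝ᵥ (P *ᵥ (G *ᵥ z)))) := by
  have hV := h.canonicalNorm_pos hx
  have hline : HasDerivAt (fun t : ℝ => x + t • v) v 0 := by
    simpa using ((hasDerivAt_id (0 : ℝ)).smul_const v).const_add x
  have hd : HasFDerivAt (canonicalNorm G P) (fderiv ℝ (canonicalNorm G P) x) (x + (0 : ℝ) • v) := by
    rw [zero_smul, add_zero]
    exact ((h.contDiffAt_canonicalNorm hx).differentiableAt (by simp)).hasFDerivAt
  set D := fderiv ℝ (canonicalNorm G P) x v with hD
  have hVd : HasDerivAt (fun t : ℝ => canonicalNorm G P (x + t • v)) D 0 := by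
    have := HasFDerivAt.comp_hasDerivAt (x := (0 : ℝ)) hd hline
    exact this
  have hlog := (hVd.log (by simpa using hV.ne')).neg
  have hzd := hasDerivAt_dilation_mulVec G hlog hline
  have hq := hasDerivAt_quadForm h.isHermitian hzd
  have hconst : (fun t : ℝ => dilatedForm G P (x + t • v)
      (Real.log (canonicalNorm G P (x + t • v)))) =ᶠ[𝓝 0] fun _ => 1 := by
    have hne : ∀ᶠ t : ℝ in 𝓝 0, x + t • v ≠ 0 :=
      hline.continuousAt.eventually_ne (by simpa using hx)
    filter_upwards [hne] with t ht
    exact h.dilatedForm_log_canonicalNorm ht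
  have hzero := hq.unique ((hasDerivAt_const (0 : ℝ) (1 : ℝ)).congr_of_eventuallyEq hconst)
  simp only [zero_smul, add_zero, Pi.neg_apply] at hzero
  rw [← hz, Matrix.mulVec_add, Matrix.mulVec_smul, dotProduct_add, dotProduct_smul,
    smul_eq_mul] at hzero
  have hz0 : 0 < z ⬝ᵥ (P *ᵥ (G *ᵥ z)) :=
    h.accretive _ (hz ▸ mt (dilation_mulVec_eq_zero G).1 hx)
  field_simp at hzero ⊢
  linarith

end IsStrictlyMonotone

/-- Homogeneity of one degree reduces the comparison to the compact unit sphere of one norm. -/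
lemma exists_canonicalNorm_le_mul {P' : Matrix (Fin n) (Fin n) ℝ} (h : IsStrictlyMonotone G P)
    (h' : IsStrictlyMonotone G P') :
    ∃ γ, ∀ x, canonicalNorm G P' x ≤ γ * canonicalNorm G P x := by
  obtain ⟨γ, hγ⟩ := (h.isCompact_canonicalNorm_le 1).exists_bound_of_continuousOn
    h'.continuous_canonicalNorm.continuousOn
  refine ⟨γ, fun x => ?_⟩
  rcases eq_or_ne x 0 with rfl | hx
  · simp
  have hV := h.canonicalNorm_pos hx
  set s := Real.log (canonicalNorm G P x) with hs
  have hexp : Real.exp s = canonicalNorm G P x := Real.exp_log hV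
  have h1 := (le_abs_self _).trans (hγ (dilation G (-s) *ᵥ x) (by
    rw [mem_ofPred_eq, h.canonicalNorm_dilation, ← hexp, ← Real.exp_add, neg_add_cancel,
      Real.exp_zero]))
  rwa [h'.canonicalNorm_dilation, Real.exp_neg, ← div_eq_inv_mul, hexp, div_le_iff₀ hV] at h1

end CanonicalNorm

/-! ### The closed loop of one mode -/

/-- The closed loop of one mode in terms of the homogenized matrix `A₀ = A + B K₀` and of
`C = B K`. -/
noncomputable def modeField {n : ℕ} (A₀ C G P : Matrix (Fin n) (Fin n) ℝ) (μ : ℝ)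
    (x : Fin n → ℝ) : Fin n → ℝ :=
  A₀ *ᵥ x + (canonicalNorm G P x) ^ (1 + μ) •
    (C *ᵥ (dilation G (-Real.log (canonicalNorm G P x)) *ᵥ x))

lemma closedLoop_feedback {n m : ℕ} (A : Matrix (Fin n) (Fin n) ℝ) (B : Matrix (Fin n) (Fin m) ℝ)
    (K₀ K : Matrix (Fin m) (Fin n) ℝ) (G P : Matrix (Fin n) (Fin n) ℝ) (μ : ℝ) :
    closedLoop A B (feedback K₀ K G P μ) = modeField (A + B * K₀) (B * K) G P μ := by
  funext x
  simp only [closedLoop, feedback, modeField, Matrix.mulVec_add, Matrix.mulVec_smul,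
    Matrix.add_mulVec, Matrix.mulVec_mulVec, Matrix.mul_assoc, add_assoc]

section ModeField

variable {n : ℕ} {A₀ C G P : Matrix (Fin n) (Fin n) ℝ} {μ : ℝ}

@[simp] lemma modeField_zero : modeField A₀ C G P μ 0 = 0 := by simp [modeField]

lemma isHomogeneousField_modeField (h : IsStrictlyMonotone G P)
    (hA₀ : A₀ * G = (G + μ • 1) * A₀) (hC : G * C = C) :
    IsHomogeneousField G μ (modeField A₀ C G P μ) := by
  intro s x
  rcases eq_or_ne x 0 with rfl | hx
  · simp
  have hV := h.canonicalNorm_pos hx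
  have h1 : A₀ *ᵥ (dilation G s *ᵥ x) = Real.exp (μ * s) • (dilation G s *ᵥ (A₀ *ᵥ x)) := by
    rw [Matrix.mulVec_mulVec, mul_dilation_of_mul_eq hA₀, dilation_add_smul_one, Matrix.smul_mul,
      Matrix.smul_mulVec, Matrix.mulVec_mulVec]
  have h2 : ∀ y, dilation G s *ᵥ (C *ᵥ y) = Real.exp s • (C *ᵥ y) := fun y => by
    have : C * 1 = G * C := by rw [hC, Matrix.mul_one]
    rw [Matrix.mulVec_mulVec, ← mul_dilation_of_mul_eq this, dilation_one, Matrix.mul_smul,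
      Matrix.mul_one, Matrix.smul_mulVec]
  have h3 : (Real.exp s * canonicalNorm G P x) ^ (1 + μ) =
      Real.exp (μ * s) * (canonicalNorm G P x ^ (1 + μ) * Real.exp s) := by
    rw [Real.mul_rpow (Real.exp_pos s).le hV.le, ← Real.exp_mul, mul_add, mul_one, Real.exp_add,
      mul_comm s μ]
    ring
  rw [modeField, modeField, h.canonicalNorm_dilation, Matrix.mulVec_add, smul_add, h1,
    Matrix.mulVec_smul, h2, h3, dilation_mulVec_mulVec,
    Real.log_mul (Real.exp_pos s).ne' hV.ne', Real.log_exp, neg_add, neg_add_cancel_comm, smul_smul,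
    smul_smul, mul_assoc]

lemma contDiffAt_modeField (h : IsStrictlyMonotone G P) {x : Fin n → ℝ} (hx : x ≠ 0) :
    ContDiffAt ℝ 1 (modeField A₀ C G P μ) x := by
  have hmul : ∀ M : Matrix (Fin n) (Fin n) ℝ, ContDiff ℝ 1 fun y : Fin n → ℝ => M *ᵥ y :=
    fun M => (Matrix.mulVecLin M).toContinuousLinearMap.contDiff
  have hlog := (h.contDiffAt_log_canonicalNorm hx).neg
  have hd : ContDiffAt ℝ 1
      (fun y => dilation G (-Real.log (canonicalNorm G P y)) *ᵥ y) x :=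
    (contDiff_dilation_mulVec G).contDiffAt.comp x (hlog.prodMk contDiffAt_id)
  exact (hmul A₀).contDiffAt.add
    (((h.contDiffAt_canonicalNorm hx).rpow_const_of_ne (h.canonicalNorm_pos hx).ne').smul
      ((hmul C).contDiffAt.comp x hd))

/-- By homogeneity the decay estimate only has to be checked on the unit sphere `V = 1`, where the
closed loop is linear. -/
lemma fderiv_canonicalNorm_modeField_le (h : IsStrictlyMonotone G P)
    (hhom : IsHomogeneousField G μ (modeField A₀ C G P μ)) {ρ : ℝ}
    (hdecay : ∀ z, z ⬝ᵥ (P *ᵥ ((A₀ + C) *ᵥ z)) ≤ -ρ * (z ⬝ᵥ (P *ᵥ (G *ᵥ z))))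
    {x : Fin n → ℝ} (hx : x ≠ 0) :
    fderiv ℝ (canonicalNorm G P) x (modeField A₀ C G P μ x) ≤
      -ρ * canonicalNorm G P x ^ (1 + μ) := by
  have hV := h.canonicalNorm_pos hx
  obtain ⟨s, hs⟩ : ∃ s, s = Real.log (canonicalNorm G P x) := ⟨_, rfl⟩
  have hexp : Real.exp s = canonicalNorm G P x := by rw [hs, Real.exp_log hV]
  set z := dilation G (-s) *ᵥ x with hz
  have hz0 : 0 < z ⬝ᵥ (P *ᵥ (G *ᵥ z)) := h.accretive _ (mt (dilation_mulVec_eq_zero G).1 hx)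
  have hVz : canonicalNorm G P z = 1 := by
    rw [hz, h.canonicalNorm_dilation, ← hexp, ← Real.exp_add, neg_add_cancel, Real.exp_zero]
  have hfz : modeField A₀ C G P μ z = (A₀ + C) *ᵥ z := by
    rw [modeField, hVz, Real.one_rpow, Real.log_one, neg_zero, dilation_zero, Matrix.one_mulVec,
      one_smul, Matrix.add_mulVec]
  have hfx : dilation G (-s) *ᵥ modeField A₀ C G P μ x = Real.exp (μ * s) • ((A₀ + C) *ᵥ z) := by
    have hxz : dilation G s *ᵥ z = x := by
      rw [hz, dilation_mulVec_mulVec, add_neg_cancel, dilation_zero, Matrix.one_mulVec]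
    have h1 := hhom s z
    rw [hxz, hfz] at h1
    rw [h1, Matrix.mulVec_smul, dilation_mulVec_mulVec, neg_add_cancel, dilation_zero,
      Matrix.one_mulVec]
  rw [h.fderiv_canonicalNorm_apply hx _ (z := z) (by rw [hz, hs]), ← hs, hfx, Matrix.mulVec_smul,
    dotProduct_smul, smul_eq_mul]
  have hpow : canonicalNorm G P x ^ (1 + μ) = canonicalNorm G P x * Real.exp (μ * s) := by
    rw [Real.rpow_add hV, Real.rpow_one, ← hexp, ← Real.exp_mul, mul_comm s μ]
  have h2 : (z ⬝ᵥ (P *ᵥ ((A₀ + C) *ᵥ z))) / (z ⬝ᵥ (P *ᵥ (G *ᵥ z))) ≤ -ρ := by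
    rw [div_le_iff₀ hz0]
    exact hdecay z
  rw [hpow, mul_div_assoc]
  have h3 : 0 ≤ canonicalNorm G P x * Real.exp (μ * s) := by positivity
  nlinarith [mul_le_mul_of_nonneg_left h2 h3]

end ModeField

/-- The congruence by `P = X⁻¹` turns the linear matrix inequality for `(X, Y)` into a bound on the
weighted inner product `xᵀ P y`. -/
lemma dotProduct_le_of_posSemidef {n m : ℕ} {A₀ G X : Matrix (Fin n) (Fin n) ℝ}
    {B : Matrix (Fin n) (Fin m) ℝ} {Y : Matrix (Fin m) (Fin n) ℝ} {ρ : ℝ} (hX : X.PosDef)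
    (hLMI : (-(X * A₀ᵀ + A₀ * X + B * Y + Yᵀ * Bᵀ + ρ • (G * X + X * Gᵀ))).PosSemidef)
    (z : Fin n → ℝ) :
    z ⬝ᵥ (X⁻¹ *ᵥ ((A₀ + B * (Y * X⁻¹)) *ᵥ z)) ≤ -ρ * (z ⬝ᵥ (X⁻¹ *ᵥ (G *ᵥ z))) := by
  have hunit : IsUnit X.det := (Matrix.isUnit_iff_isUnit_det _).1 hX.isUnit
  have hXt : Xᵀ = X := by simpa using hX.isHermitian.eq
  have hPt : (X⁻¹)ᵀ = X⁻¹ := by simpa using hX.inv.isHermitian.eq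
  set w := X⁻¹ *ᵥ z with hw
  have hzw : X *ᵥ w = z := by
    rw [hw, Matrix.mulVec_mulVec, Matrix.mul_nonsing_inv _ hunit, Matrix.one_mulVec]
  have hP : ∀ y, z ⬝ᵥ (X⁻¹ *ᵥ y) = w ⬝ᵥ y := fun y => by
    rw [Matrix.dotProduct_mulVec z, ← Matrix.mulVec_transpose, hPt]
  have htr : ∀ M : Matrix (Fin n) (Fin n) ℝ, w ⬝ᵥ (Mᵀ *ᵥ w) = w ⬝ᵥ (M *ᵥ w) := fun M => by
    rw [Matrix.dotProduct_mulVec, ← Matrix.mulVec_transpose, Matrix.transpose_transpose,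
      dotProduct_comm]
  have h1 := hLMI.dotProduct_mulVec_nonneg w
  have e1 : X * A₀ᵀ = (A₀ * X)ᵀ := by rw [Matrix.transpose_mul, hXt]
  have e2 : Yᵀ * Bᵀ = (B * Y)ᵀ := by rw [Matrix.transpose_mul]
  have e3 : X * Gᵀ = (G * X)ᵀ := by rw [Matrix.transpose_mul, hXt]
  rw [e1, e2, e3, star_trivial, Matrix.neg_mulVec, dotProduct_neg] at h1
  simp only [Matrix.add_mulVec, Matrix.smul_mulVec, dotProduct_add, dotProduct_smul, htr,
    smul_eq_mul] at h1
  have e4 : (A₀ + B * (Y * X⁻¹)) *ᵥ z = (A₀ * X) *ᵥ w + (B * Y) *ᵥ w := by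
    rw [Matrix.add_mulVec, ← Matrix.mulVec_mulVec w A₀ X, hzw, hw]
    simp only [Matrix.mulVec_mulVec, Matrix.mul_assoc]
  have e5 : G *ᵥ z = (G * X) *ᵥ w := by rw [← Matrix.mulVec_mulVec, hzw]
  rw [hP, hP, e4, e5, dotProduct_add]
  linarith

/-- `V` is a proper Lyapunov function, differentiable off the origin, that decays at least at the
rate `ρ V ^ (1 + μ)` along the vector field `φ`. Nothing is required of `φ` at the origin, where it
may be discontinuous, or unbounded nearby. -/
structure IsStrictLyapunov {n : ℕ} (φ : (Fin n → ℝ) → (Fin n → ℝ)) (V : (Fin n → ℝ) → ℝ)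
    (ρ μ : ℝ) : Prop where
  contDiffAt : ∀ x, x ≠ 0 → ContDiffAt ℝ 1 φ x
  continuous : Continuous V
  map_zero : V 0 = 0
  pos : ∀ x, x ≠ 0 → 0 < V x
  differentiableAt : ∀ x, x ≠ 0 → DifferentiableAt ℝ V x
  decay : ∀ x, x ≠ 0 → fderiv ℝ V x (φ x) ≤ -ρ * V x ^ (1 + μ)
  isCompact_le : ∀ R, IsCompact {x | V x ≤ R}

namespace IsStrictLyapunov

variable {n : ℕ} {φ : (Fin n → ℝ) → (Fin n → ℝ)} {V : (Fin n → ℝ) → ℝ} {ρ μ : ℝ}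
  (h : IsStrictLyapunov φ V ρ μ)

include h

lemma nonneg (x : Fin n → ℝ) : 0 ≤ V x := by
  rcases eq_or_ne x 0 with rfl | hx
  · exact h.map_zero.ge
  · exact (h.pos x hx).le

lemma eq_zero_iff {x : Fin n → ℝ} : V x = 0 ↔ x = 0 :=
  ⟨fun hx => by_contra fun hne => (h.pos x hne).ne' hx, fun hx => hx ▸ h.map_zero⟩

/-- Small values of `V` force the state to be small. -/
lemma exists_le_imp_norm_lt {ε : ℝ} (hε : 0 < ε) : ∃ η > 0, ∀ x, V x ≤ η → ‖x‖ < ε := by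
  have hcl : IsClosed {x : Fin n → ℝ | ε ≤ ‖x‖} := isClosed_le continuous_const continuous_norm
  rcases ({x | V x ≤ 1} ∩ {x | ε ≤ ‖x‖}).eq_empty_or_nonempty with he | he
  · refine ⟨1, one_pos, fun x hx => not_le.1 fun hx' => ?_⟩
    have : x ∈ {x | V x ≤ 1} ∩ {x | ε ≤ ‖x‖} := ⟨hx, hx'⟩
    simp [he] at this
  · obtain ⟨y, hy, hmin⟩ := ((h.isCompact_le 1).inter_right hcl).exists_isMinOn he
      h.continuous.continuousOn
    have hy0 : y ≠ 0 := norm_pos_iff.1 (hε.trans_le hy.2)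
    refine ⟨min 1 (V y / 2), lt_min one_pos (half_pos (h.pos y hy0)),
      fun x hx => not_le.1 fun hx' => ?_⟩
    have h1 : V y ≤ V x := hmin ⟨hx.trans (min_le_left _ _), hx'⟩
    have h2 := hx.trans (min_le_right _ _)
    linarith [h.pos y hy0]

lemma exists_norm_lt_imp_le {c : ℝ} (hc : 0 < c) : ∃ δ > 0, ∀ x, ‖x‖ < δ → V x ≤ c := by
  have h1 : ∀ᶠ x in 𝓝 (0 : Fin n → ℝ), V x < c :=
    h.continuous.continuousAt.eventually_lt continuousAt_const (by simpa [h.map_zero] using hc)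
  obtain ⟨δ, hδ, hball⟩ := Metric.eventually_nhds_iff.1 h1
  exact ⟨δ, hδ, fun x hx => (hball (by simpa using hx)).le⟩

end IsStrictLyapunov

/-! ### Filippov solutions away from the discontinuity -/

lemma filippov_subset_singleton {n : ℕ} {φ : (Fin n → ℝ) → (Fin n → ℝ)} {x : Fin n → ℝ}
    (hφ : ContinuousAt φ x) : filippov φ x ⊆ {φ x} := by
  intro v hv
  rw [mem_singleton_iff, ← dist_le_zero]
  refine le_of_forall_pos_le_add fun ε hε => ?_
  rw [zero_add]
  obtain ⟨δ, hδ, hball⟩ := Metric.continuousAt_iff.1 hφ ε hε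
  simp only [filippov, mem_iInter] at hv
  have h1 := hv δ hδ ∅ measure_empty
  have h2 : closure (convexHull ℝ (φ '' (Metric.ball x δ \ ∅))) ⊆ Metric.closedBall (φ x) ε := by
    refine closure_minimal (convexHull_min ?_ (convex_closedBall _ _)) Metric.isClosed_closedBall
    rintro _ ⟨y, hy, rfl⟩
    exact (hball hy.1).le
  exact h2 h1

/-- Filippov's regularization commutes with a linear change of coordinates. -/
lemma smul_map_mem_filippov {n : ℕ} {φ : (Fin n → ℝ) → (Fin n → ℝ)}
    (L : (Fin n → ℝ) ≃L[ℝ] (Fin n → ℝ)) {c : ℝ} (hφ : ∀ x, φ (L x) = c • L (φ x))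
    {x v : Fin n → ℝ} (hv : v ∈ filippov φ x) : c • L v ∈ filippov φ (L x) := by
  simp only [filippov, mem_iInter] at hv ⊢
  intro δ hδ Z hZ
  obtain ⟨δ', hδ', hball⟩ := Metric.continuousAt_iff.1 (L.continuous.continuousAt (x := x)) δ hδ
  have hZ' : volume (L ⁻¹' Z) = 0 := by
    rw [Measure.addHaar_preimage_continuousLinearEquiv, hZ, mul_zero]
  have h1 := hv δ' hδ' (L ⁻¹' Z) hZ'
  set M : (Fin n → ℝ) →L[ℝ] (Fin n → ℝ) := c • (L : (Fin n → ℝ) →L[ℝ] (Fin n → ℝ)) with hM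
  have h2 : M v ∈ closure (M '' convexHull ℝ (φ '' (Metric.ball x δ' \ L ⁻¹' Z))) :=
    image_closure_subset_closure_image M.continuous (mem_image_of_mem M h1)
  have h3 : M '' convexHull ℝ (φ '' (Metric.ball x δ' \ L ⁻¹' Z)) ⊆
      convexHull ℝ (φ '' (Metric.ball (L x) δ \ Z)) := by
    rw [← ContinuousLinearMap.coe_coe, LinearMap.image_convexHull]
    refine convexHull_mono ?_
    rintro _ ⟨_, ⟨y, hy, rfl⟩, rfl⟩
    refine ⟨L y, ⟨hball hy.1, hy.2⟩, ?_⟩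
    rw [hφ]
    rfl
  exact closure_mono h3 h2

section Solution

variable {n : ℕ} {ι : Type*} {f : ι → (Fin n → ℝ) → (Fin n → ℝ)} {σ : ℝ → ι} {T : ℝ}
  {x : ℝ → Fin n → ℝ}

lemma IsSolution.continuousOn (hx : IsSolution f σ T x) : ContinuousOn x (Icc 0 T) := by
  obtain ⟨hT, v, hv, hxv, -⟩ := hx
  have h1 : ContinuousOn (fun t => x 0 + ∫ s in (0 : ℝ)..t, v s) (Icc 0 T) := by
    have := intervalIntegral.continuousOn_primitive_interval (μ := volume) (f := v)
      (a := 0) (b := T) (by rwa [← intervalIntegrable_iff'])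
    rw [uIcc_of_le hT] at this
    exact continuousOn_const.add this
  exact h1.congr hxv

/-- Where the active vector field is continuous, a Filippov solution is a classical one (from the
right, so that switching instants need no separate treatment). -/
lemma IsSolution.hasDerivWithinAt (hx : IsSolution f σ T x) {t : ℝ} (ht : t ∈ Ico 0 T)
    (hσ : ∀ᶠ s in 𝓝[>] t, σ s = σ t) (hf : ∀ᶠ y in 𝓝 (x t), ContinuousAt (f (σ t)) y) :
    HasDerivWithinAt x (f (σ t) (x t)) (Ici t) t := by
  have hcont := hx.continuousOn
  obtain ⟨hT, v, hv, hxv, hae⟩ := hx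
  have hIcc : Icc 0 T ∈ 𝓝[>] t :=
    mem_of_superset (Ioo_mem_nhdsGT ht.2) fun s hs => ⟨ht.1.trans hs.1.le, hs.2.le⟩
  have hxt : Tendsto x (𝓝[>] t) (𝓝 (x t)) :=
    (hcont t ⟨ht.1, ht.2.le⟩).mono_left (le_inf inf_le_left (le_principal_iff.2 hIcc))
  have hlim : Tendsto v (𝓝[>] t ⊓ ae volume) (𝓝 (f (σ t) (x t))) := by
    have h1 : Tendsto (fun s => f (σ t) (x s)) (𝓝[>] t ⊓ ae volume) (𝓝 (f (σ t) (x t))) :=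
      (hf.self_of_nhds.tendsto.comp hxt).mono_left inf_le_left
    refine h1.congr' ?_
    have h2 : ∀ᶠ s in 𝓝[>] t ⊓ ae volume, s ∈ Icc 0 T → v s ∈ filippov (f (σ s)) (x s) :=
      Eventually.filter_mono inf_le_right ((ae_restrict_iff' measurableSet_Icc).1 hae)
    filter_upwards [h2, Eventually.filter_mono inf_le_left hσ,
      Eventually.filter_mono inf_le_left (hxt.eventually hf),
      Eventually.filter_mono inf_le_left hIcc] with s hs hs1 hs2 hs3
    have h3 := hs hs3
    rw [hs1] at h3
    exact (filippov_subset_singleton hs2 h3).symm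
  have hmeas : StronglyMeasurableAtFilter v (𝓝[>] t) volume :=
    ⟨Ioc 0 T, mem_of_superset (Ioo_mem_nhdsGT ht.2) fun s hs => ⟨ht.1.trans_lt hs.1, hs.2.le⟩,
      ((intervalIntegrable_iff_integrableOn_Ioc_of_le hT).1 hv).aestronglyMeasurable⟩
  have hint : IntervalIntegrable v volume 0 t := by
    refine hv.mono_set ?_
    rw [uIcc_of_le ht.1, uIcc_of_le hT]
    exact Icc_subset_Icc_right ht.2.le
  have hd : HasDerivWithinAt (fun u => x 0 + ∫ s in (0 : ℝ)..u, v s) (f (σ t) (x t)) (Ici t) t :=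
    (intervalIntegral.integral_hasDerivWithinAt_of_tendsto_ae_right hint hmeas hlim).const_add _
  refine hd.congr_of_eventuallyEq ?_ (hxv t ⟨ht.1, ht.2.le⟩)
  filter_upwards [Ico_mem_nhdsGE ht.2] with s hs
  exact hxv s ⟨ht.1.trans hs.1, hs.2.le⟩

/-- Rescaling of time by `c` and a linear change of coordinates carry solutions to solutions. -/
lemma IsSolution.rescale (hx : IsSolution f σ T x) (L : (Fin n → ℝ) ≃L[ℝ] (Fin n → ℝ)) {c : ℝ}
    (hc : 0 < c) (hf : ∀ i y, f i (L y) = c • L (f i y)) :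
    IsSolution f (fun t => σ (c * t)) (c⁻¹ * T) (fun t => L (x (c * t))) := by
  obtain ⟨hT, v, hv, hxv, hae⟩ := hx
  have hmem : ∀ t, t ∈ Icc 0 (c⁻¹ * T) → c * t ∈ Icc 0 T := fun t ht =>
    ⟨mul_nonneg hc.le ht.1, by
      have := mul_le_mul_of_nonneg_left ht.2 hc.le
      rwa [mul_inv_cancel_left₀ hc.ne'] at this⟩
  refine ⟨by positivity, fun t => c • L (v (c * t)), ?_, fun t ht => ?_, ?_⟩
  · have h1 := hv.comp_mul_left (c := c)
    rw [zero_div, div_eq_inv_mul] at h1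
    have h2 : IntervalIntegrable (fun t => L (v (c * t))) volume 0 (c⁻¹ * T) :=
      ⟨(L : (Fin n → ℝ) →L[ℝ] (Fin n → ℝ)).integrable_comp h1.1,
        (L : (Fin n → ℝ) →L[ℝ] (Fin n → ℝ)).integrable_comp h1.2⟩
    exact h2.smul c
  · have hsub : IntervalIntegrable v volume 0 (c * t) := by
      refine hv.mono_set ?_
      rw [uIcc_of_le (hmem t ht).1, uIcc_of_le hT]
      exact Icc_subset_Icc_right (hmem t ht).2
    have h1 : ∫ s in (0 : ℝ)..t, c • L (v (c * s)) = L (∫ s in (0 : ℝ)..(c * t), v s) := by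
      rw [intervalIntegral.integral_smul,
        intervalIntegral.smul_integral_comp_mul_left (fun s => L (v s)) c, mul_zero]
      exact ContinuousLinearMap.intervalIntegral_comp_comm
        (L : (Fin n → ℝ) →L[ℝ] (Fin n → ℝ)) hsub
    beta_reduce
    rw [h1, mul_zero, ← map_add, ← hxv _ (hmem t ht)]
  · rw [ae_restrict_iff' measurableSet_Icc] at hae ⊢
    have h1 : ∀ᵐ t, c * t ∈ Icc 0 T → v (c * t) ∈ filippov (f (σ (c * t))) (x (c * t)) := by
      rw [ae_iff] at hae ⊢
      have := Real.volume_preimage_mul_left hc.ne'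
        {s | ¬(s ∈ Icc 0 T → v s ∈ filippov (f (σ s)) (x s))}
      rw [hae, mul_zero] at this
      exact this
    filter_upwards [h1] with t ht hmt
    exact smul_map_mem_filippov L (hf _) (ht (hmem t hmt))

end Solution

/-- The dilation as a continuous linear automorphism. -/
noncomputable def dilationEquiv {n : ℕ} (G : Matrix (Fin n) (Fin n) ℝ) (s : ℝ) :
    (Fin n → ℝ) ≃L[ℝ] (Fin n → ℝ) :=
  LinearEquiv.toContinuousLinearEquiv
    { Matrix.mulVecLin (dilation G s) with
      invFun := fun x => dilation G (-s) *ᵥ x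
      left_inv := fun x => by simp [← dilation_add]
      right_inv := fun x => by simp [← dilation_add] }

/-! ### Decay of the Lyapunov function of the active mode -/

/-- The mean value inequality for right derivatives. -/
lemma sub_le_mul_sub_of_hasDerivWithinAt_Ici {u u' : ℝ → ℝ} {a b c : ℝ} (hab : a ≤ b)
    (hu : ContinuousOn u (Icc a b)) (hu' : ∀ t ∈ Ico a b, HasDerivWithinAt u (u' t) (Ici t) t)
    (hc : ∀ t ∈ Ico a b, u' t ≤ c) : u b - u a ≤ c * (b - a) := by
  have hB : ∀ t, HasDerivAt (fun t => u a + c * (t - a)) c t := fun t => by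
    simpa using (((hasDerivAt_id t).sub_const a).const_mul c).const_add (u a)
  have := image_le_of_deriv_right_le_deriv_boundary hu hu' (B := fun t => u a + c * (t - a))
    (B' := fun _ => c) (by simp) (fun t _ => (hB t).continuousAt.continuousWithinAt)
    (fun t _ => (hB t).hasDerivWithinAt) hc (right_mem_Icc.2 hab)
  linarith

section Decay

variable {n : ℕ} {ι : Type*} {f : ι → (Fin n → ℝ) → (Fin n → ℝ)} {σ : ℝ → ι} {T : ℝ}
  {x : ℝ → Fin n → ℝ} {V : (Fin n → ℝ) → ℝ} {ρ μ a b : ℝ} {i : ι}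

lemma IsSolution.hasDerivWithinAt_of_mode (hx : IsSolution f σ T x)
    (hf : ∀ y, y ≠ 0 → ContDiffAt ℝ 1 (f i) y) (ha : 0 ≤ a) (hb : b ≤ T)
    (hσ : ∀ t ∈ Ico a b, σ t = i) {t : ℝ} (ht : t ∈ Ico a b) (hxt : x t ≠ 0) :
    HasDerivWithinAt x (f i (x t)) (Ici t) t := by
  have h1 := hσ t ht
  rw [← h1]
  refine hx.hasDerivWithinAt ⟨ha.trans ht.1, ht.2.trans_le hb⟩ ?_ ?_
  · filter_upwards [Ioo_mem_nhdsGT ht.2] with s hs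
    rw [h1, hσ s ⟨ht.1.trans hs.1.le, hs.2⟩]
  · filter_upwards [isOpen_ne.mem_nhds hxt] with y hy
    rw [h1]
    exact (hf y hy).continuousAt

namespace IsStrictLyapunov

variable (h : IsStrictLyapunov (f i) V ρ μ) (hx : IsSolution f σ T x) (ha : 0 ≤ a) (hab : a ≤ b)
  (hb : b ≤ T) (hσ : ∀ t ∈ Ico a b, σ t = i)

include h hx ha hb

lemma continuousOn_comp : ContinuousOn (fun t => V (x t)) (Icc a b) :=
  h.continuous.comp_continuousOn (hx.continuousOn.mono (Icc_subset_Icc ha hb))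

include hσ

lemma hasDerivWithinAt_comp {t : ℝ} (ht : t ∈ Ico a b) (hxt : x t ≠ 0) :
    HasDerivWithinAt (fun t => V (x t)) (fderiv ℝ V (x t) (f i (x t))) (Ici t) t :=
  (h.differentiableAt _ hxt).hasFDerivAt.comp_hasDerivWithinAt t
    (hx.hasDerivWithinAt_of_mode h.contDiffAt ha hb hσ ht hxt)

include hab

lemma comp_le (hρ : 0 ≤ ρ) : V (x b) ≤ V (x a) := by
  have hcont := h.continuousOn_comp hx ha hb
  -- `c` is the last time at which `V` does not exceed its initial value.
  obtain ⟨c, ⟨hc, hcV⟩, hmax⟩ : ∃ c, IsGreatest (Icc a b ∩ {t | V (x t) ≤ V (x a)}) c := by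
    refine IsCompact.exists_isGreatest ?_ ⟨a, left_mem_Icc.2 hab, le_refl (V (x a))⟩
    exact isCompact_Icc.of_isClosed_subset
      (hcont.preimage_isClosed_of_isClosed isClosed_Icc isClosed_Iic) inter_subset_left
  refine le_trans ?_ (show V (x c) ≤ V (x a) from hcV)
  rcases hc.2.eq_or_lt with rfl | hcb
  · exact le_rfl
  have hlt : ∀ t ∈ Ioc c b, V (x a) < V (x t) := fun t ht => by
    by_contra hle
    exact (hmax ⟨⟨hc.1.trans ht.1.le, ht.2⟩, not_lt.1 hle⟩).not_gt ht.1
  have hstep : ∀ t ∈ Ioc c b, V (x b) ≤ V (x t) := fun t ht => by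
    have hne : ∀ s ∈ Ico t b, x s ≠ 0 := fun s hs h0 => by
      have := hlt s ⟨ht.1.trans_le hs.1, hs.2.le⟩
      rw [h0, h.map_zero] at this
      exact this.not_ge (h.nonneg _)
    have hat : a ≤ t := hc.1.trans ht.1.le
    have := sub_le_mul_sub_of_hasDerivWithinAt_Ici (c := 0) ht.2
      (hcont.mono (Icc_subset_Icc_left hat))
      (fun s hs => h.hasDerivWithinAt_comp hx ha hb hσ ⟨hat.trans hs.1, hs.2⟩ (hne s hs))
      (fun s hs => (h.decay _ (hne s hs)).trans (by
        have := Real.rpow_nonneg (h.nonneg (x s)) (1 + μ)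
        nlinarith))
    linarith
  have hlim : Tendsto (fun t => V (x t)) (𝓝[>] c) (𝓝 (V (x c))) :=
    (hcont c hc).mono_left (le_inf inf_le_left (le_principal_iff.2
      (mem_of_superset (Ioo_mem_nhdsGT hcb) fun s hs => ⟨hc.1.trans hs.1.le, hs.2.le⟩)))
  refine ge_of_tendsto hlim ?_
  filter_upwards [Ioo_mem_nhdsGT hcb] with t ht
  exact hstep t ⟨ht.1, ht.2.le⟩

omit hab in
lemma comp_pos (hρ : 0 ≤ ρ) (hpos : 0 < V (x b)) {t : ℝ} (ht : t ∈ Icc a b) : 0 < V (x t) :=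
  hpos.trans_le (h.comp_le hx (ha.trans ht.1) ht.2 hb
    (fun s hs => hσ s ⟨ht.1.trans hs.1, hs.2⟩) hρ)

lemma eq_zero_of_eq_zero (hρ : 0 ≤ ρ) (h0 : x a = 0) : x b = 0 := by
  have h1 := h.comp_le hx ha hab hb hσ hρ
  rw [h0, h.map_zero] at h1
  exact h.eq_zero_iff.1 (le_antisymm h1 (h.nonneg _))

/-- For `μ ≠ 0` the quantity `V ^ (-μ) / μ` grows at least at the rate `ρ`. -/
lemma mul_sub_le_rpow_sub_rpow (hμ : μ ≠ 0) (hρ : 0 ≤ ρ) (hpos : 0 < V (x b)) :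
    ρ * (b - a) ≤ V (x b) ^ (-μ) / μ - V (x a) ^ (-μ) / μ := by
  have hV : ∀ t ∈ Icc a b, 0 < V (x t) := fun t ht => h.comp_pos hx ha hb hσ hρ hpos ht
  have hne : ∀ t ∈ Icc a b, x t ≠ 0 := fun t ht h0 => by
    have := hV t ht
    rw [h0, h.map_zero] at this
    exact this.ne rfl
  have hcont := h.continuousOn_comp hx ha hb
  have key := sub_le_mul_sub_of_hasDerivWithinAt_Ici (c := -ρ) hab
    (u := fun t => V (x t) ^ (-μ) / -μ)
    (u' := fun t => V (x t) ^ (-μ - 1) * fderiv ℝ V (x t) (f i (x t)))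
    ((hcont.rpow_const fun t ht => Or.inl (hV t ht).ne').div_const _)
    (fun t ht => by
      have hm := Ico_subset_Icc_self ht
      have h1 := ((h.hasDerivWithinAt_comp hx ha hb hσ ht (hne t hm)).rpow_const (p := -μ)
        (Or.inl (hV t hm).ne')).div_const (-μ)
      refine h1.congr_deriv ?_
      field_simp)
    (fun t ht => by
      have hm := Ico_subset_Icc_self ht
      have h1 := mul_le_mul_of_nonneg_left (h.decay _ (hne t hm))
        (Real.rpow_nonneg (hV t hm).le (-μ - 1))
      have h2 : V (x t) ^ (-μ - 1) * V (x t) ^ (1 + μ) = 1 := by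
        rw [← Real.rpow_add (hV t hm), show -μ - 1 + (1 + μ) = 0 by ring, Real.rpow_zero]
      calc _ ≤ _ := h1
        _ = -ρ * (V (x t) ^ (-μ - 1) * V (x t) ^ (1 + μ)) := by ring
        _ = -ρ := by rw [h2, mul_one])
  simp only [div_neg] at key
  linarith

lemma comp_le_exp_mul (hμ : μ = 0) (hρ : 0 ≤ ρ) :
    V (x b) ≤ Real.exp (-ρ * (b - a)) * V (x a) := by
  rcases (h.nonneg (x b)).eq_or_lt with h0 | hpos
  · rw [← h0]
    exact mul_nonneg (Real.exp_pos _).le (h.nonneg _)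
  have hV : ∀ t ∈ Icc a b, 0 < V (x t) := fun t ht => h.comp_pos hx ha hb hσ hρ hpos ht
  have hne : ∀ t ∈ Icc a b, x t ≠ 0 := fun t ht h0 => by
    have := hV t ht
    rw [h0, h.map_zero] at this
    exact this.ne rfl
  have key := sub_le_mul_sub_of_hasDerivWithinAt_Ici (c := -ρ) hab
    (u := fun t => Real.log (V (x t)))
    ((h.continuousOn_comp hx ha hb).log fun t ht => (hV t ht).ne')
    (fun t ht => (h.hasDerivWithinAt_comp hx ha hb hσ ht (hne t (Ico_subset_Icc_self ht))).log
      (hV t (Ico_subset_Icc_self ht)).ne')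
    (fun t ht => by
      have hm := Ico_subset_Icc_self ht
      have h1 := h.decay _ (hne t hm)
      rw [hμ, add_zero, Real.rpow_one] at h1
      rwa [div_le_iff₀ (hV t hm)])
  have hVa := hV a (left_mem_Icc.2 hab)
  rw [← Real.log_le_log_iff hpos (by positivity),
    Real.log_mul (Real.exp_pos _).ne' hVa.ne', Real.log_exp]
  linarith

/-- For `μ < 0` a mode drives `V` to zero within the time `V ^ (-μ) / (ρ (-μ))`. -/
lemma eq_zero_of_rpow_le (hμ : μ < 0) (hρ : 0 ≤ ρ)
    (hlt : V (x a) ^ (-μ) ≤ ρ * -μ * (b - a)) : x b = 0 := by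
  by_contra hne
  have hpos := h.pos _ hne
  have h1 := h.mul_sub_le_rpow_sub_rpow hx ha hab hb hσ hμ.ne hρ hpos
  have h2 : 0 < V (x b) ^ (-μ) := Real.rpow_pos_of_pos hpos _
  rw [← sub_div, ← neg_div_neg_eq, le_div_iff₀ (by linarith)] at h1
  nlinarith

/-- For `μ > 0` a mode drives `V` below a bound that does not depend on the initial value. -/
lemma comp_le_of_pos (hμ : 0 < μ) (hρ : 0 < ρ) (hab' : a < b) :
    V (x b) ≤ (ρ * μ * (b - a)) ^ (-μ⁻¹) := by
  have hτ : 0 < ρ * μ * (b - a) := mul_pos (mul_pos hρ hμ) (sub_pos.2 hab')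
  rcases (h.nonneg (x b)).eq_or_lt with h0 | hpos
  · rw [← h0]
    exact Real.rpow_nonneg hτ.le _
  have h1 := h.mul_sub_le_rpow_sub_rpow hx ha hab hb hσ hμ.ne' hρ.le hpos
  have h2 : 0 ≤ V (x a) ^ (-μ) := Real.rpow_nonneg (h.nonneg _) _
  rw [← sub_div, le_div_iff₀ hμ] at h1
  have h3 : ρ * μ * (b - a) ≤ V (x b) ^ (-μ) := by nlinarith
  have h4 := Real.rpow_le_rpow_of_nonpos hτ h3 (neg_nonpos.2 (inv_nonneg.2 hμ.le))
  rwa [← Real.rpow_mul hpos.le, neg_mul_neg, mul_inv_cancel₀ hμ.ne', Real.rpow_one] at h4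

end IsStrictLyapunov

end Decay

/-! ### Switching signals -/

section Signal

variable {ι : Type*} {σ : ℝ → ι}

lemma IsSwitchingSignal.eq_of_forall_notMem_Ioo (hσ : IsSwitchingSignal σ) {a b : ℝ} (ha : 0 ≤ a)
    (hno : ∀ t ∈ Ioo a b, t ∉ switchingTimes σ) {t : ℝ} (ht : t ∈ Ico a b) : σ t = σ a := by
  let _ : TopologicalSpace ι := ⊥
  have _ : DiscreteTopology ι := ⟨rfl⟩
  have hcont : ContinuousOn σ (Ico a b) := by
    intro s hs
    have hright : ∀ᶠ r in 𝓝[>] s, σ r = σ s := hσ.1 s (ha.trans hs.1)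
    have hev : ∀ᶠ r in 𝓝[Ico a b] s, σ r = σ s := by
      rcases hs.1.eq_or_lt with rfl | has
      · refine Eventually.filter_mono (nhdsWithin_mono _ Ico_subset_Ici_self) ?_
        rw [← Ioi_insert, nhdsWithin_insert, eventually_sup]
        exact ⟨by simp, hright⟩
      · have hleft : ∀ᶠ r in 𝓝[<] s, σ r = σ s := by
          by_contra hcon
          exact hno s ⟨has, hs.2⟩ ⟨ha.trans_lt has, hcon⟩
        refine Eventually.filter_mono nhdsWithin_le_nhds ?_
        rw [nhds_eq_nhdsWithin_sup_nhdsWithin s Iic_union_Ioi.symm, ← Iio_insert, nhdsWithin_insert,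
          eventually_sup, eventually_sup]
        exact ⟨⟨by simp, hleft⟩, hright⟩
    exact tendsto_nhds_of_eventually_eq hev
  exact isPreconnected_Ico.constant hcont ht (left_mem_Ico.2 (ht.1.trans_lt ht.2))

lemma IsSwitchingSignal.eq_of_forall_notMem_Ioc (hσ : IsSwitchingSignal σ) {a b : ℝ} (ha : 0 ≤ a)
    (hab : a ≤ b) (hno : ∀ t ∈ Ioc a b, t ∉ switchingTimes σ) : σ b = σ a := by
  rcases hab.eq_or_lt with rfl | hab
  · rfl
  have hleft : ∀ᶠ r in 𝓝[<] b, σ r = σ b := by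
    by_contra hcon
    exact hno b (right_mem_Ioc.2 hab) ⟨ha.trans_lt hab, hcon⟩
  obtain ⟨r, hr, hrab⟩ := (hleft.and (Ioo_mem_nhdsLT hab)).exists
  rw [← hr]
  exact hσ.eq_of_forall_notMem_Ioo ha (fun t ht => hno t (Ioo_subset_Ioc_self ht))
    ⟨hrab.1.le, hrab.2⟩

lemma notMem_switchingTimes_of_forall_eq {a b : ℝ} {i : ι} (h : ∀ s ∈ Ioo a b, σ s = i) {t : ℝ}
    (ht : t ∈ Ioo a b) : t ∉ switchingTimes σ := by
  rintro ⟨-, hnot⟩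
  refine hnot ?_
  filter_upwards [Ioo_mem_nhdsLT ht.1] with s hs
  rw [h s ⟨hs.1, hs.2.trans ht.2⟩, h t ht]

/-- The one-sided limits of a switching signal exclude accumulation points of its switching
instants. -/
lemma IsSwitchingSignal.finite_switchingTimes (hσ : IsSwitchingSignal σ) (t : ℝ) :
    (switchingTimes σ ∩ Ioc 0 t).Finite := by
  by_contra hinf
  obtain ⟨p, hp, hacc⟩ := Set.Infinite.exists_accPt_of_subset_isCompact hinf
    (isCompact_Icc (a := (0 : ℝ)) (b := t)) (inter_subset_right.trans Ioc_subset_Icc_self)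
  rw [accPt_iff_frequently_nhdsNE] at hacc
  refine hacc ?_
  rw [← Iio_union_Ioi, nhdsWithin_union, eventually_sup]
  constructor
  · rcases hp.1.eq_or_lt with rfl | hp0
    · filter_upwards [self_mem_nhdsWithin] with y hy hmem
      exact lt_asymm hy hmem.2.1
    · obtain ⟨i, hi⟩ := hσ.2 p hp0
      obtain ⟨a, ha, hai⟩ := (mem_nhdsLT_iff_exists_Ioo_subset).1 hi
      filter_upwards [Ioo_mem_nhdsLT ha] with y hy hmem
      exact notMem_switchingTimes_of_forall_eq hai hy hmem.1
  · obtain ⟨b, hb, hbi⟩ := (mem_nhdsGT_iff_exists_Ioo_subset).1 (hσ.1 p hp.1)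
    filter_upwards [Ioo_mem_nhdsGT hb] with y hy hmem
    exact notMem_switchingTimes_of_forall_eq hbi hy hmem.1

end Signal

/-! ### Uniqueness and homogeneity of the switched system -/

section Switched

variable {n : ℕ} {ι : Type*} {f : ι → (Fin n → ℝ) → (Fin n → ℝ)} {V : ι → (Fin n → ℝ) → ℝ}
  {ρ : ι → ℝ} {μ : ℝ} {σ : ℝ → ι} {T : ℝ} {x y : ℝ → Fin n → ℝ}

/-- Off the origin the modes are locally Lipschitz, and a solution that reaches the origin stays
there because the Lyapunov function of the active mode does not increase. -/
lemma IsSolution.eqOn (h : ∀ i, IsStrictLyapunov (f i) (V i) (ρ i) μ) (hρ : ∀ i, 0 ≤ ρ i)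
    (hσ : ∀ t, 0 ≤ t → ∀ᶠ s in 𝓝[>] t, σ s = σ t) (hx : IsSolution f σ T x)
    (hy : IsSolution f σ T y) (h0 : x 0 = y 0) : EqOn x y (Icc 0 T) := by
  have hclosed : IsClosed ({t | x t = y t} ∩ Icc 0 T) := by
    have := (hx.continuousOn.sub hy.continuousOn).preimage_isClosed_of_isClosed isClosed_Icc
      (isClosed_singleton (x := (0 : Fin n → ℝ)))
    convert! this using 1
    ext t
    simp [sub_eq_zero, and_comm]
  refine fun t ht => hclosed.Icc_subset_of_forall_mem_nhdsWithin h0 ?_ ht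
  rintro t ⟨hxy : x t = y t, ht⟩
  obtain ⟨b, hb, hbσ⟩ := (mem_nhdsGT_iff_exists_Ioo_subset).1 (hσ t ht.1)
  have hmode : ∀ c ≤ b, ∀ s ∈ Ico t c, σ s = σ t := fun c hc s hs => by
    rcases hs.1.eq_or_lt with rfl | hts
    · rfl
    · exact hbσ ⟨hts, hs.2.trans_le hc⟩
  have htb : t < min b T := lt_min hb ht.2
  rcases eq_or_ne (x t) 0 with hxt | hxt
  · filter_upwards [Ioo_mem_nhdsGT htb] with s hs
    have hsb := hs.2.le.trans (min_le_left _ _)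
    have hsT := hs.2.le.trans (min_le_right _ _)
    exact ((h (σ t)).eq_zero_of_eq_zero hx ht.1 hs.1.le hsT (hmode s hsb) (hρ _) hxt).trans
      ((h (σ t)).eq_zero_of_eq_zero hy ht.1 hs.1.le hsT (hmode s hsb) (hρ _)
        (hxy ▸ hxt)).symm
  · obtain ⟨K, U, hU, hLip⟩ := ((h (σ t)).contDiffAt _ hxt).exists_lipschitzOnWith
    have hW : U ∩ {0}ᶜ ∈ 𝓝 (x t) := inter_mem hU (isOpen_ne.mem_nhds hxt)
    have hright : ∀ z : ℝ → Fin n → ℝ, IsSolution f σ T z → z t = x t →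
        ∀ᶠ s in 𝓝[>] t, z s ∈ U ∩ {0}ᶜ := fun z hz hzt => by
      have h1 : Tendsto z (𝓝[>] t) (𝓝 (z t)) :=
        (hz.continuousOn t ⟨ht.1, ht.2.le⟩).mono_left (le_inf inf_le_left (le_principal_iff.2
          (mem_of_superset (Ioo_mem_nhdsGT ht.2) fun s hs => ⟨ht.1.trans hs.1.le, hs.2.le⟩)))
      rw [hzt] at h1
      exact h1.eventually hW
    obtain ⟨c, hc, hcW⟩ := (mem_nhdsGT_iff_exists_Ioo_subset).1
      ((hright x hx rfl).and (hright y hy hxy.symm))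
    set d := min c (min b T) with hd
    have htd : t < d := lt_min hc htb
    have hdb : d ≤ b := (min_le_right _ _).trans (min_le_left _ _)
    have hdT : d ≤ T := (min_le_right _ _).trans (min_le_right _ _)
    have hmem : ∀ s ∈ Ico t d, x s ∈ U ∩ {0}ᶜ ∧ y s ∈ U ∩ {0}ᶜ := fun s hs => by
      rcases hs.1.eq_or_lt with rfl | hts
      · exact ⟨mem_of_mem_nhds hW, hxy ▸ mem_of_mem_nhds hW⟩
      · exact hcW ⟨hts, hs.2.trans_le (min_le_left _ _)⟩
    have hsub : Icc t d ⊆ Icc 0 T := Icc_subset_Icc ht.1 hdT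
    have hEq := ODE_solution_unique_of_mem_Icc_right (v := fun _ => f (σ t)) (s := fun _ => U)
      (fun _ _ => hLip) (hx.continuousOn.mono hsub)
      (fun s hs => hx.hasDerivWithinAt_of_mode (h _).contDiffAt ht.1 hdT (hmode d hdb) hs
        (hmem s hs).1.2)
      (fun s hs => (hmem s hs).1.1) (hy.continuousOn.mono hsub)
      (fun s hs => hy.hasDerivWithinAt_of_mode (h _).contDiffAt ht.1 hdT (hmode d hdb) hs
        (hmem s hs).2.2)
      (fun s hs => (hmem s hs).2.1) hxy
    filter_upwards [Ioo_mem_nhdsGT htd] with s hs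
    exact hEq (Ioo_subset_Icc_self hs)

lemma isHomogeneousSwitched_of_isStrictLyapunov {G : Matrix (Fin n) (Fin n) ℝ}
    (h : ∀ i, IsStrictLyapunov (f i) (V i) (ρ i) μ) (hρ : ∀ i, 0 ≤ ρ i)
    (hhom : ∀ i, IsHomogeneousField G μ (f i)) : IsHomogeneousSwitched G μ f := by
  intro s σ hσ T x hx
  set c := Real.exp (μ * s) with hc
  have hc0 : 0 < c := Real.exp_pos _
  rw [Real.exp_neg, ← hc]
  have hsol : IsSolution f (fun t => σ (c * t)) (c⁻¹ * T) (fun t => dilation G s *ᵥ x (c * t)) :=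
    hx.rescale (dilationEquiv G s) hc0 fun i y => hhom i s y
  refine ⟨hsol, fun y hy hy0 => ?_⟩
  refine IsSolution.eqOn h hρ (fun t ht => ?_) hy hsol (by simpa using hy0)
  have htend : Tendsto (fun r => c * r) (𝓝[>] t) (𝓝[>] (c * t)) := by
    refine tendsto_nhdsWithin_iff.2 ⟨?_, ?_⟩
    · exact ((continuous_const_mul c).tendsto t).mono_left nhdsWithin_le_nhds
    · filter_upwards [self_mem_nhdsWithin] with r hr
      exact mul_lt_mul_of_pos_left hr hc0
  exact htend.eventually (hσ.1 (c * t) (mul_nonneg hc0.le ht))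

/-- The origin is absorbing for the switched system. -/
lemma IsSolution.eq_zero_of_le (h : ∀ i, IsStrictLyapunov (f i) (V i) (ρ i) μ)
    (hρ : ∀ i, 0 ≤ ρ i) (hσ : IsSwitchingSignal σ) (hx : IsSolution f σ T x) {a b : ℝ}
    (ha : 0 ≤ a) (hab : a ≤ b) (hb : b ≤ T) (h0 : x a = 0) : x b = 0 := by
  have hclosed : IsClosed ({t | x t = 0} ∩ Icc a b) := by
    rw [inter_comm]
    exact (hx.continuousOn.mono (Icc_subset_Icc ha hb)).preimage_isClosed_of_isClosed
      isClosed_Icc isClosed_singleton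
  refine hclosed.Icc_subset_of_forall_mem_nhdsWithin h0 ?_ (right_mem_Icc.2 hab)
  rintro t ⟨hxt : x t = 0, ht⟩
  have ht0 : 0 ≤ t := ha.trans ht.1
  obtain ⟨d, hd, hdσ⟩ := (mem_nhdsGT_iff_exists_Ioo_subset).1 (hσ.1 t ht0)
  filter_upwards [Ioo_mem_nhdsGT (lt_min hd ht.2)] with s hs
  refine (h (σ t)).eq_zero_of_eq_zero hx ht0 hs.1.le
    ((hs.2.le.trans (min_le_right _ _)).trans hb) (fun r hr => ?_) (hρ _) hxt
  rcases hr.1.eq_or_lt with rfl | htr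
  · rfl
  · exact hdσ ⟨htr, (hr.2.trans hs.2).trans_le (min_le_left _ _)⟩

/-! ### Stability under a minimum dwell time -/

/-- A trajectory that starts at a level which every mode extinguishes within the dwell time `τ`,
even after one increase by the factor `γ`, meets at most one switching instant before it reaches
the origin. -/
lemma IsSolution.le_and_eq_zero_of_minDwell (h : ∀ i, IsStrictLyapunov (f i) (V i) (ρ i) μ)
    {ρ₀ γ τ c : ℝ} (hρ₀ : 0 < ρ₀) (hρ : ∀ i, ρ₀ ≤ ρ i) (hμ : μ < 0) (hτ : 0 < τ) (hγ : 1 ≤ γ)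
    (hVγ : ∀ i j x, V j x ≤ γ * V i x) (hc0 : 0 ≤ c) (hc : (γ * c) ^ (-μ) ≤ ρ₀ * -μ * τ)
    (hσ : σ ∈ minDwell ι τ) (hx : IsSolution f σ T x) (hxc : V (σ 0) (x 0) ≤ c) {t : ℝ}
    (ht : t ∈ Icc 0 T) : V (σ t) (x t) ≤ γ * c ∧ (2 * τ ≤ t → x t = 0) := by
  obtain ⟨hsig, hdwell⟩ := hσ
  have hρ' : ∀ i, 0 ≤ ρ i := fun i => hρ₀.le.trans (hρ i)
  have hcγ : c ≤ γ * c := le_mul_of_one_le_left hc0 hγ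
  have hext : ∀ i a, 0 ≤ a → a + τ ≤ T → (∀ s ∈ Ico a (a + τ), σ s = i) → V i (x a) ≤ γ * c →
      x (a + τ) = 0 := fun i a ha haT hmode hVa => by
    refine (h i).eq_zero_of_rpow_le hx ha (by linarith) haT hmode hμ (hρ' i) ?_
    have h1 : V i (x a) ^ (-μ) ≤ (γ * c) ^ (-μ) :=
      Real.rpow_le_rpow ((h i).nonneg _) hVa (by linarith)
    have h2 : ρ₀ * (-μ * τ) ≤ ρ i * (-μ * τ) :=
      mul_le_mul_of_nonneg_right (hρ i) (mul_nonneg (by linarith) hτ.le)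
    rw [add_sub_cancel_left]
    linarith
  have hzero : ∀ a, 0 ≤ a → a ≤ t → x a = 0 → x t = 0 := fun a ha hat h0 =>
    hx.eq_zero_of_le h hρ' hsig ha hat ht.2 h0
  rcases (switchingTimes σ ∩ Ioc 0 t).eq_empty_or_nonempty with he | hne
  · have hno : ∀ s ∈ Ioc 0 t, s ∉ switchingTimes σ := fun s hs hmem => by
      have : s ∈ switchingTimes σ ∩ Ioc 0 t := ⟨hmem, hs⟩
      simp [he] at this
    have hmode : ∀ s ∈ Ico 0 t, σ s = σ 0 := fun s hs =>
      hsig.eq_of_forall_notMem_Ioo le_rfl (fun r hr => hno r (Ioo_subset_Ioc_self hr)) hs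
    refine ⟨?_, fun h2 => ?_⟩
    · rw [hsig.eq_of_forall_notMem_Ioc le_rfl ht.1 hno]
      exact (((h _).comp_le hx le_rfl ht.1 ht.2 hmode (hρ' _)).trans hxc).trans hcγ
    · refine hzero (0 + τ) (by linarith) (by linarith) (hext (σ 0) 0 le_rfl ?_ ?_ (hxc.trans hcγ))
      · linarith [ht.2]
      · exact fun s hs => hmode s ⟨hs.1, by linarith [hs.2]⟩
  · -- `t₁` is the first switching instant.
    obtain ⟨t₁, ⟨ht₁, ht₁0, ht₁t⟩, hmin⟩ := Set.exists_min_image _ id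
      (hsig.finite_switchingTimes t) hne
    have hno : ∀ s ∈ Ioo 0 t₁, s ∉ switchingTimes σ := fun s hs hmem =>
      (hmin s ⟨hmem, hs.1, hs.2.le.trans ht₁t⟩).not_gt hs.2
    have hmode : ∀ s ∈ Ico 0 t₁, σ s = σ 0 := fun s hs =>
      hsig.eq_of_forall_notMem_Ioo le_rfl hno hs
    have hno₁ : ∀ s ∈ Ioo t₁ (t₁ + τ), s ∉ switchingTimes σ := fun s hs hmem => by
      have := hdwell t₁ ht₁ s hmem hs.1
      linarith [hs.2]
    have hmode₁ : ∀ s ∈ Ico t₁ (t₁ + τ), σ s = σ t₁ := fun s hs =>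
      hsig.eq_of_forall_notMem_Ioo ht₁0.le hno₁ hs
    have hV₁ : V (σ t₁) (x t₁) ≤ γ * c :=
      (hVγ (σ 0) _ _).trans (mul_le_mul_of_nonneg_left
        (((h _).comp_le hx le_rfl ht₁0.le (ht₁t.trans ht.2) hmode (hρ' _)).trans hxc)
        (by linarith))
    rcases lt_or_ge t (t₁ + τ) with hlt | hge
    · refine ⟨?_, fun h2 => ?_⟩
      · rw [hmode₁ t ⟨ht₁t, hlt⟩]
        exact ((h _).comp_le hx ht₁0.le ht₁t ht.2
          (fun s hs => hmode₁ s ⟨hs.1, hs.2.trans hlt⟩) (hρ' _)).trans hV₁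
      · refine hzero (0 + τ) (by linarith) (by linarith)
          (hext (σ 0) 0 le_rfl ?_ ?_ (hxc.trans hcγ))
        · linarith [ht.2]
        · exact fun s hs => hmode s ⟨hs.1, by linarith [hs.2]⟩
    · have h0 : x t = 0 := hzero (t₁ + τ) (by linarith) hge
        (hext (σ t₁) t₁ ht₁0.le (hge.trans ht.2) hmode₁ hV₁)
      refine ⟨?_, fun _ => h0⟩
      rw [h0, (h _).map_zero]
      positivity

lemma isLocallyFiniteTimeStable_minDwell [Finite ι] [Nonempty ι]
    (h : ∀ i, IsStrictLyapunov (f i) (V i) (ρ i) μ)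
    {ρ₀ γ τ : ℝ} (hρ₀ : 0 < ρ₀) (hρ : ∀ i, ρ₀ ≤ ρ i) (hμ : μ < 0) (hτ : 0 < τ) (hγ : 1 ≤ γ)
    (hVγ : ∀ i j x, V j x ≤ γ * V i x) : IsLocallyFiniteTimeStable f (minDwell ι τ) := by
  have hγ0 : 0 < γ := by linarith
  set B := ρ₀ * -μ * τ with hB
  have hB0 : 0 < B := mul_pos (mul_pos hρ₀ (by linarith)) hτ
  set R := B ^ (-μ)⁻¹ with hR
  have hR0 : 0 < R := Real.rpow_pos_of_pos hB0 _
  have hRB : ∀ c, 0 ≤ c → γ * c ≤ R → (γ * c) ^ (-μ) ≤ B := fun c hc hcR => by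
    refine (Real.rpow_le_rpow (by positivity) hcR (by linarith)).trans ?_
    rw [hR, ← Real.rpow_mul hB0.le, inv_mul_cancel₀ (by linarith), Real.rpow_one]
  have hδ : ∀ c > 0, ∃ δ > 0, ∀ i x, ‖x‖ < δ → V i x ≤ c := fun c hc => by
    obtain ⟨i₀⟩ := ‹Nonempty ι›
    obtain ⟨δ, hδ, hδc⟩ := (h i₀).exists_norm_lt_imp_le (div_pos hc hγ0)
    refine ⟨δ, hδ, fun i x hx => (hVγ i₀ i x).trans ?_⟩
    rw [← le_div_iff₀' hγ0]
    exact hδc x hx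
  refine ⟨fun ε hε => ?_, ?_⟩
  · obtain ⟨i₀⟩ := ‹Nonempty ι›
    obtain ⟨η, hη, hηε⟩ := (h i₀).exists_le_imp_norm_lt hε
    set c := min R (η / γ) / γ with hc
    have hc0 : 0 < c := div_pos (lt_min hR0 (div_pos hη hγ0)) hγ0
    have hγc : γ * c = min R (η / γ) := mul_div_cancel₀ _ hγ0.ne'
    obtain ⟨δ, hδ0, hδc⟩ := hδ c hc0
    refine ⟨δ, hδ0, fun σ hσ T x hx hx0 t ht => hηε _ ?_⟩
    have h1 := (hx.le_and_eq_zero_of_minDwell h hρ₀ hρ hμ hτ hγ hVγ hc0.le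
      (hRB c hc0.le (hγc.trans_le (min_le_left _ _))) hσ (hδc _ _ hx0) ht).1
    refine (hVγ (σ t) i₀ _).trans ?_
    rw [← le_div_iff₀' hγ0]
    exact h1.trans (hγc.trans_le (min_le_right _ _))
  · have hc0 : 0 < R / γ := div_pos hR0 hγ0
    obtain ⟨δ, hδ0, hδc⟩ := hδ (R / γ) hc0
    refine ⟨δ, hδ0, fun _ => 2 * τ, fun σ hσ T x hx hx0 t ht h2 => ?_⟩
    exact (hx.le_and_eq_zero_of_minDwell h hρ₀ hρ hμ hτ hγ hVγ hc0.le
      (hRB _ hc0.le (mul_div_cancel₀ _ hγ0.ne').le) hσ (hδc _ _ hx0) ht).2 h2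

/-- The last `τ` time units contain at most one switching instant, and the mode that is active
before it (or throughout) has been active for the time `τ`. -/
lemma IsSolution.exists_le_of_minDwell (h : ∀ i, IsStrictLyapunov (f i) (V i) (ρ i) μ)
    {ρ₀ γ τ : ℝ} (hρ₀ : 0 < ρ₀) (hρ : ∀ i, ρ₀ ≤ ρ i) (hμ : 0 < μ) (hτ : 0 < τ) (hγ : 1 ≤ γ)
    (hVγ : ∀ i j x, V j x ≤ γ * V i x)
    (hσ : σ ∈ minDwell ι τ) (hx : IsSolution f σ T x) {t : ℝ} (ht : t ∈ Icc 0 T)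
    (h2 : 2 * τ ≤ t) : ∃ i, V i (x t) ≤ γ * (ρ₀ * μ * τ) ^ (-μ⁻¹) := by
  obtain ⟨hsig, hdwell⟩ := hσ
  have hB0 : 0 < ρ₀ * μ * τ := by positivity
  have hR0 : 0 ≤ (ρ₀ * μ * τ) ^ (-μ⁻¹) := Real.rpow_nonneg hB0.le _
  have hbound : ∀ b, τ ≤ b → b ≤ t → (∀ s ∈ Ioo (b - τ) b, s ∉ switchingTimes σ) →
      V (σ (b - τ)) (x b) ≤ (ρ₀ * μ * τ) ^ (-μ⁻¹) := fun b hb hbt hno => by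
    have h0 : 0 ≤ b - τ := by linarith
    have h1 := (h (σ (b - τ))).comp_le_of_pos hx h0 (by linarith) (hbt.trans ht.2)
      (fun s hs => hsig.eq_of_forall_notMem_Ioo h0 hno hs) hμ (hρ₀.trans_le (hρ _))
      (by linarith)
    refine h1.trans (Real.rpow_le_rpow_of_nonpos hB0 ?_ (neg_nonpos.2 (inv_nonneg.2 hμ.le)))
    rw [sub_sub_cancel]
    have := hρ (σ (b - τ))
    gcongr
  by_cases hex : ∃ t₁ ∈ Ioc (t - τ) t, t₁ ∈ switchingTimes σ
  · obtain ⟨t₁, ht₁, hmem⟩ := hex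
    have ht₁0 : 0 ≤ t₁ := by linarith [ht₁.1]
    have h1 := hbound t₁ (by linarith [ht₁.1]) ht₁.2 fun s hs hs' => by
      linarith [hdwell s hs' t₁ hmem hs.2, hs.1]
    have h3 := (h (σ t₁)).comp_le hx ht₁0 ht₁.2 ht.2
      (fun s hs => hsig.eq_of_forall_notMem_Ioo ht₁0 (fun r hr hr' => by
        linarith [hdwell t₁ hmem r hr' hr.1, hr.2, ht₁.1]) hs) (hρ₀.le.trans (hρ _))
    exact ⟨σ t₁, h3.trans ((hVγ (σ (t₁ - τ)) _ _).trans
      (mul_le_mul_of_nonneg_left h1 (by linarith)))⟩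
  · push Not at hex
    exact ⟨_, (hbound t (by linarith) le_rfl fun s hs => hex s (Ioo_subset_Ioc_self hs)).trans
      (le_mul_of_one_le_left hR0 hγ)⟩

lemma exists_isFixedTimeAttractive_minDwell [Finite ι]
    (h : ∀ i, IsStrictLyapunov (f i) (V i) (ρ i) μ)
    {ρ₀ γ τ : ℝ} (hρ₀ : 0 < ρ₀) (hρ : ∀ i, ρ₀ ≤ ρ i) (hμ : 0 < μ) (hτ : 0 < τ) (hγ : 1 ≤ γ)
    (hVγ : ∀ i j x, V j x ≤ γ * V i x) :
    ∃ M : Set (Fin n → ℝ), IsCompact M ∧ IsFixedTimeAttractive f (minDwell ι τ) M :=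
  ⟨⋃ i, {x | V i x ≤ γ * (ρ₀ * μ * τ) ^ (-μ⁻¹)}, isCompact_iUnion fun i => (h i).isCompact_le _,
    2 * τ, fun _ hσ _ _ hx _ ht h2 =>
      mem_iUnion.2 (hx.exists_le_of_minDwell h hρ₀ hρ hμ hτ hγ hVγ hσ ht h2)⟩

/-! ### Stability under an average dwell time -/

/-- Exponential decay between the switching instants, and a factor `γ` at each of them. -/
lemma IsSolution.le_pow_numSwitches_mul (h : ∀ i, IsStrictLyapunov (f i) (V i) (ρ i) μ)
    {ρ₀ γ : ℝ} (hρ₀ : 0 ≤ ρ₀) (hρ : ∀ i, ρ₀ ≤ ρ i) (hμ : μ = 0) (hγ : 0 ≤ γ)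
    (hVγ : ∀ i j x, V j x ≤ γ * V i x) (hσ : IsSwitchingSignal σ) (hx : IsSolution f σ T x)
    {t : ℝ} (ht : t ∈ Icc 0 T) :
    V (σ t) (x t) ≤ γ ^ numSwitches σ t 0 * (Real.exp (-ρ₀ * t) * V (σ 0) (x 0)) := by
  have hdecay : ∀ i a b, 0 ≤ a → a ≤ b → b ≤ T → (∀ s ∈ Ico a b, σ s = i) →
      V i (x b) ≤ Real.exp (-ρ₀ * (b - a)) * V i (x a) := fun i a b ha hab hb hmode => by
    refine ((h i).comp_le_exp_mul hx ha hab hb hmode hμ (hρ₀.trans (hρ i))).trans ?_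
    refine mul_le_mul_of_nonneg_right (Real.exp_le_exp.2 ?_) ((h i).nonneg _)
    exact mul_le_mul_of_nonneg_right (neg_le_neg (hρ i)) (sub_nonneg.2 hab)
  have hexp : ∀ a b, Real.exp (-ρ₀ * (b - a)) * Real.exp (-ρ₀ * a) = Real.exp (-ρ₀ * b) :=
    fun a b => by rw [← Real.exp_add]; ring_nf
  obtain ⟨k, hk⟩ : ∃ k, numSwitches σ t 0 = k := ⟨_, rfl⟩
  rw [hk]
  induction k generalizing t with
  | zero =>
    rw [numSwitches, Set.ncard_eq_zero (hσ.finite_switchingTimes t)] at hk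
    have hno : ∀ s ∈ Ioc 0 t, s ∉ switchingTimes σ := fun s hs hmem => by
      have : s ∈ switchingTimes σ ∩ Ioc 0 t := ⟨hmem, hs⟩
      simp [hk] at this
    rw [hσ.eq_of_forall_notMem_Ioc le_rfl ht.1 hno, pow_zero, one_mul]
    have := hdecay (σ 0) 0 t le_rfl ht.1 ht.2 fun s hs =>
      hσ.eq_of_forall_notMem_Ioo le_rfl (fun r hr => hno r (Ioo_subset_Ioc_self hr)) hs
    rwa [sub_zero] at this
  | succ k ih =>
    have hfin := hσ.finite_switchingTimes t
    have hne : (switchingTimes σ ∩ Ioc 0 t).Nonempty := by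
      rw [← Set.ncard_pos hfin]
      change 0 < numSwitches σ t 0
      omega
    -- `t₁` is the last switching instant, and the mode is constant on `(a, t₁)`.
    obtain ⟨t₁, ⟨ht₁, ht₁0, ht₁t⟩, hmax⟩ := Set.exists_max_image _ id hfin hne
    obtain ⟨i, hi⟩ := hσ.2 t₁ ht₁0
    obtain ⟨a, ha, hai⟩ := (mem_nhdsLT_iff_exists_Ioo_subset).1 hi
    obtain ⟨r, hr₁, hr₂⟩ := exists_between (max_lt ha ht₁0)
    have har : a < r := (le_max_left _ _).trans_lt hr₁
    have hr0 : 0 < r := (le_max_right _ _).trans_lt hr₁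
    have hno : ∀ s ∈ Ioc t₁ t, s ∉ switchingTimes σ := fun s hs hmem =>
      (hmax s ⟨hmem, ht₁0.trans hs.1, hs.2⟩).not_gt hs.1
    have hset : switchingTimes σ ∩ Ioc 0 t = insert t₁ (switchingTimes σ ∩ Ioc 0 r) := by
      ext s
      constructor
      · rintro ⟨hs, hs0, hst⟩
        rcases lt_trichotomy s t₁ with hlt | rfl | hgt
        · refine Or.inr ⟨hs, hs0, not_lt.1 fun hrs => ?_⟩
          exact notMem_switchingTimes_of_forall_eq hai ⟨har.trans hrs, hlt⟩ hs
        · exact Or.inl rfl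
        · exact absurd hs (hno s ⟨hgt, hst⟩)
      · rintro (rfl | ⟨hs, hs0, hsr⟩)
        · exact ⟨ht₁, ht₁0, ht₁t⟩
        · exact ⟨hs, hs0, hsr.trans (hr₂.le.trans ht₁t)⟩
    have hkr : numSwitches σ r 0 = k := by
      rw [numSwitches, hset, Set.ncard_insert_of_notMem
        (fun hmem => hmem.2.2.not_gt hr₂) (hσ.finite_switchingTimes r)] at hk
      exact Nat.succ_injective hk
    have hrT : r ≤ T := hr₂.le.trans (ht₁t.trans ht.2)
    have h1 := ih ⟨hr0.le, hrT⟩ hkr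
    rw [show σ r = i from hai ⟨har, hr₂⟩] at h1
    have h2 := hdecay i r t₁ hr0.le hr₂.le (ht₁t.trans ht.2)
      fun s hs => hai ⟨har.trans_le hs.1, hs.2⟩
    have h3 := hVγ i (σ t₁) (x t₁)
    have h4 := hdecay (σ t₁) t₁ t ht₁0.le ht₁t ht.2 fun s hs =>
      hσ.eq_of_forall_notMem_Ioo ht₁0.le (fun r hr => hno r (Ioo_subset_Ioc_self hr)) hs
    rw [hσ.eq_of_forall_notMem_Ioc ht₁0.le ht₁t hno]
    calc V (σ t₁) (x t)
        ≤ Real.exp (-ρ₀ * (t - t₁)) * (γ * (Real.exp (-ρ₀ * (t₁ - r)) *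
          (γ ^ k * (Real.exp (-ρ₀ * r) * V (σ 0) (x 0))))) := by
          refine h4.trans (mul_le_mul_of_nonneg_left ?_ (Real.exp_pos _).le)
          refine h3.trans (mul_le_mul_of_nonneg_left ?_ hγ)
          exact h2.trans (mul_le_mul_of_nonneg_left h1 (Real.exp_pos _).le)
      _ = γ ^ (k + 1) * ((Real.exp (-ρ₀ * (t - t₁)) * (Real.exp (-ρ₀ * (t₁ - r)) *
          Real.exp (-ρ₀ * r))) * V (σ 0) (x 0)) := by ring
      _ = γ ^ (k + 1) * (Real.exp (-ρ₀ * t) * V (σ 0) (x 0)) := by rw [hexp, hexp]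

lemma isGloballyExponentiallyStable_averageDwell
    (h : ∀ i, IsStrictLyapunov (f i) (V i) (ρ i) μ)
    {ρ₀ γ N₀ τd c C : ℝ} (hρ₀ : 0 < ρ₀) (hρ : ∀ i, ρ₀ ≤ ρ i) (hμ : μ = 0) (hγ : 1 ≤ γ)
    (hVγ : ∀ i j x, V j x ≤ γ * V i x) (hτd : Real.log γ / ρ₀ < τd) (hc : 0 < c) (hC : 0 < C)
    (hcV : ∀ i x, c * ‖x‖ ≤ V i x) (hVC : ∀ i x, V i x ≤ C * ‖x‖) :
    IsGloballyExponentiallyStable f (averageDwell ι N₀ τd) := by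
  have hlog : 0 ≤ Real.log γ := Real.log_nonneg hγ
  have hγ0 : 0 < γ := by linarith
  have hτd0 : 0 < τd := (div_nonneg hlog hρ₀.le).trans_lt hτd
  refine ⟨C / c * Real.exp (N₀ * Real.log γ), by positivity, ρ₀ - Real.log γ / τd, ?_,
    fun σ hσ T x hx t ht => ?_⟩
  · rw [gt_iff_lt, sub_pos, div_lt_iff₀ hτd0]
    rwa [div_lt_iff₀' hρ₀] at hτd
  have h1 := hx.le_pow_numSwitches_mul h hρ₀.le hρ hμ hγ0.le hVγ hσ.1 ht
  have hpow : γ ^ numSwitches σ t 0 ≤ Real.exp ((N₀ + t / τd) * Real.log γ) := by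
    rw [← Real.rpow_natCast, Real.rpow_def_of_pos hγ0, mul_comm (Real.log γ)]
    exact Real.exp_le_exp.2 (mul_le_mul_of_nonneg_right (hσ.2 t ht.1) hlog)
  have h2 : c * ‖x t‖ ≤ Real.exp ((N₀ + t / τd) * Real.log γ) *
      (Real.exp (-ρ₀ * t) * (C * ‖x 0‖)) := by
    refine (hcV (σ t) (x t)).trans (h1.trans ?_)
    refine mul_le_mul hpow (mul_le_mul_of_nonneg_left (hVC _ _) (Real.exp_pos _).le)
      (mul_nonneg (Real.exp_pos _).le ((h _).nonneg _)) (Real.exp_pos _).le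
  have h3 : Real.exp ((N₀ + t / τd) * Real.log γ) * Real.exp (-ρ₀ * t) =
      Real.exp (N₀ * Real.log γ) * Real.exp (-(ρ₀ - Real.log γ / τd) * t) := by
    rw [← Real.exp_add, ← Real.exp_add]
    ring_nf
  rw [← mul_assoc, h3, ← le_div_iff₀' hc] at h2
  refine h2.trans_eq ?_
  ring

end Switched

/-! ### Comparison of the modes and of the norms -/

lemma exists_forall_canonicalNorm_le_mul {n : ℕ} {ι : Type*} [Fintype ι]
    {G : Matrix (Fin n) (Fin n) ℝ} {P : ι → Matrix (Fin n) (Fin n) ℝ}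
    (h : ∀ i, IsStrictlyMonotone G (P i)) :
    ∃ γ : ℝ, 1 < γ ∧ ∀ i j x, canonicalNorm G (P j) x ≤ γ * canonicalNorm G (P i) x := by
  choose g hg using fun i j => exists_canonicalNorm_le_mul (h i) (h j)
  have hnn : ∀ i, 0 ≤ ∑ j, |g i j| := fun i => Finset.sum_nonneg fun j _ => abs_nonneg _
  have hnn' : 0 ≤ ∑ i, ∑ j, |g i j| := Finset.sum_nonneg fun i _ => hnn i
  refine ⟨2 + ∑ i, ∑ j, |g i j|, by linarith, fun i j x => (hg i j x).trans ?_⟩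
  refine mul_le_mul_of_nonneg_right ?_ ((h i).canonicalNorm_nonneg x)
  have h1 : |g i j| ≤ ∑ j, |g i j| :=
    Finset.single_le_sum (f := fun j => |g i j|) (fun j _ => abs_nonneg _) (Finset.mem_univ j)
  have h2 : ∑ j, |g i j| ≤ ∑ i, ∑ j, |g i j| :=
    Finset.single_le_sum (f := fun i => ∑ j, |g i j|) (fun i _ => hnn i) (Finset.mem_univ i)
  linarith [le_abs_self (g i j)]

/-- A Lyapunov function that is homogeneous for the standard dilation is comparable to the norm. -/
lemma IsStrictLyapunov.exists_norm_bounds {n : ℕ} {φ : (Fin n → ℝ) → (Fin n → ℝ)}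
    {V : (Fin n → ℝ) → ℝ} {ρ μ : ℝ} (h : IsStrictLyapunov φ V ρ μ)
    (hhom : ∀ r, 0 < r → ∀ x, V (r • x) = r * V x) :
    ∃ c > 0, ∃ C > 0, ∀ x, c * ‖x‖ ≤ V x ∧ V x ≤ C * ‖x‖ := by
  obtain ⟨η, hη, hlow⟩ := h.exists_le_imp_norm_lt one_pos
  obtain ⟨δ, hδ, hup⟩ := h.exists_norm_lt_imp_le one_pos
  refine ⟨η, hη, 2 / δ, by positivity, fun x => ?_⟩
  rcases eq_or_ne x 0 with rfl | hx
  · simp [h.map_zero]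
  have hV := h.pos x hx
  have hn : 0 < ‖x‖ := norm_pos_iff.2 hx
  constructor
  · have h1 := hlow ((η / V x) • x) (by rw [hhom _ (by positivity), div_mul_cancel₀ _ hV.ne'])
    rw [norm_smul, Real.norm_of_nonneg (by positivity), div_mul_eq_mul_div, div_lt_one hV] at h1
    exact h1.le
  · have h1 := hup ((δ / (2 * ‖x‖)) • x) (by
      rw [norm_smul, Real.norm_of_nonneg (by positivity)]
      field_simp
      norm_num)
    rw [hhom _ (by positivity), div_mul_eq_mul_div, div_le_one (by positivity)] at h1
    rw [div_mul_eq_mul_div, le_div_iff₀ hδ]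
    linarith

end HomSwitched

open HomSwitched in
theorem mainTheorem2 {n m N : ℕ} (hN : 0 < N)
    (A : Fin N → Matrix (Fin n) (Fin n) ℝ) (B : Fin N → Matrix (Fin n) (Fin m) ℝ)
    (hAB : ∀ i, IsControllable (A i) (B i))
    -- the homogenizing linear equations, with a common `G₀`
    (G₀ : Matrix (Fin n) (Fin n) ℝ) (Y₀ : Fin N → Matrix (Fin m) (Fin n) ℝ)
    (hY₀ : ∀ i, A i * G₀ - G₀ * A i + B i * Y₀ i = A i)
    (hG₀ : ∀ i, G₀ * B i = 0)
    (μ : ℝ)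
    (Gd : Matrix (Fin n) (Fin n) ℝ) (hGd : Gd = 1 + μ • G₀)
    (K₀ : Fin N → Matrix (Fin m) (Fin n) ℝ) (hK₀ : ∀ i, K₀ i = Y₀ i * (G₀ - 1)⁻¹)
    (A₀ : Fin N → Matrix (Fin n) (Fin n) ℝ) (hA₀ : ∀ i, A₀ i = A i + B i * K₀ i)
    -- the mode-dependent linear matrix inequalities
    (X : Fin N → Matrix (Fin n) (Fin n) ℝ) (Y : Fin N → Matrix (Fin m) (Fin n) ℝ)
    (ρ : Fin N → ℝ) (hρ : ∀ i, 0 < ρ i) (hX : ∀ i, (X i).PosDef)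
    (hLMI : ∀ i, (-(X i * (A₀ i)ᵀ + A₀ i * X i + B i * Y i + (Y i)ᵀ * (B i)ᵀ +
      ρ i • (Gd * X i + X i * Gdᵀ))).PosSemidef)
    (hGX : ∀ i, (Gd * X i + X i * Gdᵀ).PosDef)
    -- the mode-dependent homogeneous norms, the feedback gains and the closed loop
    (V : Fin N → (Fin n → ℝ) → ℝ) (hV : ∀ i, V i = canonicalNorm Gd (X i)⁻¹)
    (K : Fin N → Matrix (Fin m) (Fin n) ℝ) (hK : ∀ i, K i = Y i * (X i)⁻¹)
    (f : Fin N → (Fin n → ℝ) → (Fin n → ℝ))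
    (hf : ∀ i, f i = closedLoop (A i) (B i) (feedback (K₀ i) (K i) Gd (X i)⁻¹ μ)) :
    -- the homogenization
    (IsUnit (G₀ - 1) ∧ (∃ ε > 0, ∀ ν : ℝ, |ν| < ε → IsAntiHurwitz (1 + ν • G₀)) ∧
      ∀ i, A₀ i * Gd = (Gd + μ • 1) * A₀ i ∧ Gd * B i = B i) ∧
    -- each `V i` is a well-defined Lyapunov function candidate, and they are comparable
    (∀ i, (∀ x, x ≠ 0 → ∃! s : ℝ, weightedNorm (X i)⁻¹ (dilation Gd (-s) *ᵥ x) = 1) ∧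
      V i 0 = 0 ∧ (∀ x, x ≠ 0 → 0 < V i x) ∧ Continuous (V i) ∧
      ContDiffOn ℝ 1 (V i) {0}ᶜ ∧ Tendsto (V i) (cocompact (Fin n → ℝ)) atTop) ∧
    (∃ γ : ℝ, 1 < γ ∧ ∀ i j x, V j x ≤ γ * V i x) ∧
    -- decay along the trajectories of each mode
    (∀ i x, x ≠ 0 → fderiv ℝ (V i) x (f i x) ≤ -ρ i * V i x ^ (1 + μ)) ∧
    -- homogeneity of the modes and of the switched closed loop
    (∀ i, IsHomogeneousField Gd μ (f i)) ∧ IsHomogeneousSwitched Gd μ f ∧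
    -- minimum dwell time
    (∀ τ : ℝ, 0 < τ →
      (μ ∈ Ico (-1 : ℝ) 0 → IsLocallyFiniteTimeStable f (minDwell (Fin N) τ)) ∧
      (0 < μ → ∃ M : Set (Fin n → ℝ),
        IsCompact M ∧ IsFixedTimeAttractive f (minDwell (Fin N) τ) M)) ∧
    -- average dwell time
    (μ = 0 → ∀ γ : ℝ, 1 ≤ γ → (∀ i j x, V j x ≤ γ * V i x) →
      ∀ N₀ τd : ℝ, Real.log γ / (⨅ i, ρ i) < τd →
        IsGloballyExponentiallyStable f (averageDwell (Fin N) N₀ τd)) := by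
  have hmono : ∀ i, IsStrictlyMonotone Gd (X i)⁻¹ := fun i =>
    isStrictlyMonotone_inv (hX i) (hGX i)
  have hunit : IsUnit (G₀ - 1) :=
    isUnit_sub_one_of_controllable (hAB ⟨0, hN⟩) (hY₀ ⟨0, hN⟩) (hG₀ ⟨0, hN⟩)
  have hA₀Gd : ∀ i, A₀ i * Gd = (Gd + μ • 1) * A₀ i := fun i => by
    rw [hA₀, hK₀, hGd]
    exact homogenized_mul_dilation_generator hunit (hY₀ i) (hG₀ i) μ
  have hGdB : ∀ i, Gd * B i = B i := fun i => by
    rw [hGd, Matrix.add_mul, Matrix.one_mul, Matrix.smul_mul, hG₀, smul_zero, add_zero]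
  have hfm : ∀ i, f i = modeField (A₀ i) (B i * K i) Gd (X i)⁻¹ μ := fun i => by
    rw [hf, closedLoop_feedback, hA₀]
  have hhom : ∀ i, IsHomogeneousField Gd μ (f i) := fun i => by
    rw [hfm]
    exact isHomogeneousField_modeField (hmono i) (hA₀Gd i)
      (by rw [← Matrix.mul_assoc, hGdB])
  have hlyap : ∀ i, IsStrictLyapunov (f i) (V i) (ρ i) μ := fun i => by
    have hhom_i := hhom i
    rw [hfm] at hhom_i
    rw [hfm, hV]
    refine ⟨fun x hx => contDiffAt_modeField (hmono i) hx, (hmono i).continuous_canonicalNorm,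
      canonicalNorm_zero, fun x hx => (hmono i).canonicalNorm_pos hx,
      fun x hx => ((hmono i).contDiffAt_canonicalNorm hx).differentiableAt (by simp),
      fun x hx => fderiv_canonicalNorm_modeField_le (hmono i) hhom_i (fun z => ?_) hx,
      (hmono i).isCompact_canonicalNorm_le⟩
    rw [hK]
    exact dotProduct_le_of_posSemidef (hX i) (hLMI i) z
  obtain ⟨γ₀, hγ₀, hVγ₀⟩ : ∃ γ : ℝ, 1 < γ ∧ ∀ i j x, V j x ≤ γ * V i x := by
    obtain ⟨γ, hγ, h⟩ := exists_forall_canonicalNorm_le_mul hmono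
    exact ⟨γ, hγ, fun i j x => by rw [hV, hV]; exact h i j x⟩
  have _ : Nonempty (Fin N) := ⟨⟨0, hN⟩⟩
  set ρ₀ := ⨅ i, ρ i with hρ₀
  have hρ₀pos : 0 < ρ₀ := by
    obtain ⟨i, hi⟩ := exists_eq_ciInf_of_finite (f := ρ)
    rw [hρ₀, ← hi]
    exact hρ i
  have hρ₀le : ∀ i, ρ₀ ≤ ρ i := fun i => ciInf_le (Set.finite_range ρ).bddBelow i
  refine ⟨⟨hunit, isAntiHurwitz_one_add_smul G₀, fun i => ⟨hA₀Gd i, hGdB i⟩⟩, fun i => ?_,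
    ⟨γ₀, hγ₀, hVγ₀⟩, fun i x hx => (hlyap i).decay x hx, hhom,
    isHomogeneousSwitched_of_isStrictLyapunov hlyap (fun i => (hρ i).le) hhom,
    fun τ hτ => ⟨fun hμ => ?_, fun hμ => ?_⟩, fun hμ γ hγ hVγ N₀ τd hτd => ?_⟩
  · refine ⟨fun x hx => ?_, (hlyap i).map_zero, (hlyap i).pos, (hlyap i).continuous, ?_, ?_⟩
    · simp only [weightedNorm_eq_one_iff]
      exact (hmono i).existsUnique_dilatedForm_eq_one hx
    · rw [hV]
      exact fun x hx => ((hmono i).contDiffAt_canonicalNorm hx).contDiffWithinAt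
    · rw [hV]
      exact (hmono i).tendsto_canonicalNorm_cocompact
  · exact isLocallyFiniteTimeStable_minDwell hlyap hρ₀pos hρ₀le hμ.2 hτ hγ₀.le hVγ₀
  · exact exists_isFixedTimeAttractive_minDwell hlyap hρ₀pos hρ₀le hμ hτ hγ₀.le hVγ₀
  · have hGd1 : Gd = 1 := by rw [hGd, hμ, zero_smul, add_zero]
    set i₀ : Fin N := ⟨0, hN⟩
    obtain ⟨c, hc, C, hC, hbd⟩ := (hlyap i₀).exists_norm_bounds fun r hr x => by
      have h1 := (hmono i₀).canonicalNorm_dilation (Real.log r) x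
      rw [hV]
      rwa [hGd1, dilation_one, Real.exp_log hr, Matrix.smul_mulVec, Matrix.one_mulVec,
        ← hGd1] at h1
    have hγpos : 0 < γ := by linarith
    refine isGloballyExponentiallyStable_averageDwell hlyap hρ₀pos hρ₀le hμ hγ hVγ hτd
      (c := c / γ) (C := γ * C) (by positivity) (by positivity) (fun i x => ?_) fun i x => ?_
    · rw [div_mul_eq_mul_div, div_le_iff₀' hγpos]
      exact (hbd x).1.trans (hVγ i i₀ x)
    · rw [mul_assoc]
      exact (hVγ i₀ i x).trans (mul_le_mul_of_nonneg_left (hbd x).2 hγpos.le)
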